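/- All spaces are real Banach spaces and all vector fields are $C^\infty$. For a vector field $f$ on $Y$ and a rooted tree $\tau=[\tau_1,\dots,\tau_k]$ let $F(\tau)(y)=f^{(k)}(y)\bigl(F(\tau_1)(y),\dots,F(\tau_k)(y)\bigr)$ be its elementary differential. The B-series method with coefficients $a(\tau)\in\mathbb R$ ($\tau$ ranging over all rooted trees) is the formal integrator $$\Phi_{hf}(y)=y+\sum_{\tau}\frac{h^{|\tau|}}{\sigma(\tau)}\,a(\tau)\,F(\tau)(y)\in Y[[h]],$$ where $|\tau|$ is the number of vertices and $\sigma(\tau)$ the number of automorphisms of $\tau$. For a smooth map $G$ on $Y$, $G\circ\Phi_{hf}$ denotes the formal power series in $h$ obtained by Taylor expansion. Given a class $\mathcal F$ of smooth maps between Banach spaces, $\Phi$ is *$\mathcal F$-functionally equivariant* if for all $Y,Z$, all $F\in\mathcal F(Y,Z)$ and all vector fields $f$ on $Y$, $$(\mathrm{id},F)\circ\Phi_{hf}=\Phi_{hg}\circ(\mathrm{id},F),\qquad g(y,z)=\bigl(f(y),F'(y)f(y)\bigr)\ \text{ on } Y\times Z;$$ and $\Phi$ *preserves $\mathcal F$-invariants*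 if $F\circ\Phi_{hf}=F$ whenever $F\in\mathcal F(Y,Z)$ and $F'(y)f(y)=0$ for all $y\in Y$. Affine, quadratic and cubic maps are the continuous polynomial maps of degree at most $1$, $2$ and $3$. (a) Every B-series method is affine functionally equivariant. (b) Every B-series method that preserves quadratic invariants is quadratic functionally equivariant. For example, for every $s$ the $s$-stage Gauss–Legendre collocation method preserves quadratic invariants and is quadratic functionally equivariant, both as a B-series and as an actual Runge–Kutta method, in the following sense (step size $1$). If $F\in\mathcal F(Y,Z)$ is quadratic and is an invariant of $f$, then every step $y_0\mapsto y_1$ for $f$ satisfies $F(y_1)=F(y_0)$. If $F$ is quadratic and $f$ is arbitrary, then the steps for $g$ from $(y_0,F(y_0))$ are exactly those to $(y_1,F(y_1))$ with $y_0\mapsto y_1$ a step for $f$. (c) No B-series method is cubic functionally equivariant, other than the exact flow up to a constant rescaling of time. That is, if a B-series method $\Phi$ is such that for no constant $r\in\mathbb R$ the series $Y(h)=\Phi_{hf}(y)$ is, for all $Y$, $f$ and $y$, the formal solution of $dY/dh=r f(Y)$, $Y(0)=y$, then $\Phi$ is not cubic functionally equivariant. -/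

import Mathlib

open scoped ContDiff Nat

universe u

noncomputable section

/-! ### Rooted trees -/

/-- Plane rooted trees: a root with an ordered tuple of `k` subtrees. -/
inductive PlaneTree : Type
  | node (k : ℕ) (child : Fin k → PlaneTree) : PlaneTree

namespace PlaneTree

/-- The number of vertices. -/
def order : PlaneTree → ℕ
  | node _ child => 1 + ∑ i, (child i).order

/-- The product of `k_v !` over all vertices `v`, where `k_v` is the number of children of `v`. -/
def branchFactorial : PlaneTree → ℕ
  | node k child => k ! * ∏ i, (child i).branchFactorial

/-- Elementary reorderings: permute the subtrees at the root, or reorder inside one subtree. -/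
inductive Reorder : PlaneTree → PlaneTree → Prop
  | perm (k : ℕ) (child : Fin k → PlaneTree) (e : Equiv.Perm (Fin k)) :
      Reorder (node k child) (node k (child ∘ e))
  | sub (k : ℕ) (child : Fin k → PlaneTree) (i : Fin k) (t : PlaneTree) :
      Reorder (child i) t → Reorder (node k child) (node k (Function.update child i t))

theorem finite_order_eq (n : ℕ) : {t : PlaneTree | t.order = n}.Finite := by
  induction n using Nat.strong_induction_on with
  | _ n ih =>
    have h1 : {t : PlaneTree | t.order < n}.Finite := by
      have : {t : PlaneTree | t.order < n} = ⋃ m ∈ Set.Iio n, {t : PlaneTree | t.order = m} := by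
        ext t; simp
      rw [this]
      exact (Set.finite_Iio n).biUnion fun m hm => ih m hm
    have h2 : (⋃ k ∈ Set.Iio n, (fun c : Fin k → PlaneTree => node k c) ''
        (Set.univ.pi fun _ => {t : PlaneTree | t.order < n})).Finite :=
      (Set.finite_Iio n).biUnion fun k _ => (Set.Finite.pi' fun _ => h1).image _ |>.subset (by
        apply Set.image_mono
        intro c hc i
        exact hc i trivial)
    refine h2.subset ?_
    rintro ⟨k, c⟩ ht
    have ht' : 1 + ∑ i, (c i).order = n := ht
    have hpos : ∀ t : PlaneTree, 1 ≤ t.order := by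
      rintro ⟨k, c⟩; exact Nat.le_add_right 1 _
    have hk : k ≤ ∑ i, (c i).order := by
      calc k = ∑ _i : Fin k, 1 := by simp
        _ ≤ _ := Finset.sum_le_sum fun i _ => hpos (c i)
    simp only [Set.mem_iUnion]
    refine ⟨k, ?_, c, ?_, rfl⟩
    · simp only [Set.mem_Iio]; omega
    · intro i _
      have : (c i).order ≤ ∑ i, (c i).order :=
        Finset.single_le_sum (f := fun i => (c i).order) (fun _ _ => Nat.zero_le _)
          (Finset.mem_univ i)
      simp only [Set.mem_ofPred_eq]; omega

/-- The plane trees with `n` vertices. -/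
def ofOrder (n : ℕ) : Finset PlaneTree := (finite_order_eq n).toFinset

/-- The elementary differential of a vector field `f` attached to a tree:
`D^k f (y) (F(t₁)(y), …, F(t_k)(y))` for the tree with subtrees `t₁, …, t_k`. -/
def elementaryDifferential {Y : Type u} [NormedAddCommGroup Y] [NormedSpace ℝ Y] (f : Y → Y) :
    PlaneTree → Y → Y
  | node k child => fun y =>
      iteratedFDeriv ℝ k f y fun i => elementaryDifferential f (child i) y

end PlaneTree

/-- (Non-plane) rooted trees: plane trees up to reordering of subtrees. -/
def ButcherTree : Type := Quot PlaneTree.Reorder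

/-- The rooted tree underlying a plane tree. -/
def PlaneTree.toRooted (t : PlaneTree) : ButcherTree := Quot.mk _ t

/-! ### Formal numerical integrators and B-series -/

/-- A one-step method as a formal series in the step size `h`: the vector field `f` on `Y` and
the initial value `y` are sent to the sequence of coefficients of `Φ_{hf}(y) ∈ Y⟦h⟧`. -/
abbrev FormalIntegrator : Type (u + 1) :=
  ∀ (Y : Type u) [NormedAddCommGroup Y] [NormedSpace ℝ Y], (Y → Y) → Y → ℕ → Y

/-- The B-series method with coefficients `a`,
`Φ_{hf}(y) = y + ∑_τ h^{|τ|} a(τ)/σ(τ) F(τ)(y)`, the sum being over all rooted trees `τ`, with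
`σ(τ)` the number of automorphisms of `τ`.
The sum is written over plane trees `t`: a rooted tree `τ` has `(∏_v k_v !)/σ(τ)` plane
representatives, and for smooth `f` all of them have the elementary differential `F(τ)`. -/
def bSeries (a : ButcherTree → ℝ) : FormalIntegrator.{u} := fun _ _ _ f y n =>
  if n = 0 then y else
    ∑ t ∈ PlaneTree.ofOrder n,
      (a t.toRooted / t.branchFactorial) • t.elementaryDifferential f y

/-- Substitution of a formal series `∑ hⁿ cₙ` in a map `F` smooth near `c₀`: the sequence of
coefficients of `F (∑ hⁿ cₙ)`. The `n`-th one is the `n`-th Taylor coefficient at `h = 0` of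
`h ↦ F (c₀ + h c₁ + ⋯ + hⁿ cₙ)` (later `cᵢ` do not influence it). -/
def formalComp {Y Z : Type u} [NormedAddCommGroup Y] [NormedSpace ℝ Y] [NormedAddCommGroup Z]
    [NormedSpace ℝ Z] (F : Y → Z) (c : ℕ → Y) (n : ℕ) : Z :=
  (n ! : ℝ)⁻¹ • iteratedDeriv n (fun h : ℝ => F (∑ i ∈ Finset.range (n + 1), h ^ i • c i)) 0

/-! ### Functional equivariance and invariants -/

/-- A class of maps `𝓕(Y, Z)` between normed spaces. -/
abbrev MapClass : Type (u + 1) :=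
  ∀ (Y Z : Type u) [NormedAddCommGroup Y] [NormedSpace ℝ Y] [NormedAddCommGroup Z]
    [NormedSpace ℝ Z], (Y → Z) → Prop

/-- Continuous affine maps. -/
def affineMaps : MapClass.{u} := fun Y Z _ _ _ _ F => ∃ A : Y →ᴬ[ℝ] Z, ∀ y, F y = A y

/-- Continuous polynomial maps of degree at most `d`. -/
def polynomialMaps (d : ℕ) : MapClass.{u} := fun Y Z _ _ _ _ F =>
  ∃ p : (k : ℕ) → ContinuousMultilinearMap ℝ (fun _ : Fin k => Y) Z,
    ∀ y, F y = ∑ k ∈ Finset.range (d + 1), p k fun _ => y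

/-- Quadratic maps. -/
def quadraticMaps : MapClass.{u} := polynomialMaps 2

/-- Cubic maps. -/
def cubicMaps : MapClass.{u} := polynomialMaps 3

/-- The augmented vector field `g(y, z) = (f(y), F'(y) f(y))`. -/
def augmentedField {Y Z : Type u} [NormedAddCommGroup Y] [NormedSpace ℝ Y]
    [NormedAddCommGroup Z] [NormedSpace ℝ Z] (F : Y → Z) (f : Y → Y) : Y × Z → Y × Z :=
  fun p => (f p.1, fderiv ℝ F p.1 (f p.1))

/-- `Φ` is `𝓕`-functionally equivariant: `(id, F) ∘ Φ_f = Φ_g ∘ (id, F)`, with `g` the augmented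
vector field, for all `F ∈ 𝓕(Y, Z)`, all smooth vector fields `f` on `Y` and all Banach spaces
`Y`, `Z`. -/
def FunctionallyEquivariant (𝓕 : MapClass.{u}) (Φ : FormalIntegrator.{u}) : Prop :=
  ∀ (Y Z : Type u) [NormedAddCommGroup Y] [NormedSpace ℝ Y] [CompleteSpace Y]
    [NormedAddCommGroup Z] [NormedSpace ℝ Z] [CompleteSpace Z] (F : Y → Z), 𝓕 Y Z F →
    ∀ f : Y → Y, ContDiff ℝ ∞ f → ∀ y : Y,
      formalComp (fun x => (x, F x)) (Φ Y f y) = Φ (Y × Z) (augmentedField F f) (y, F y)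

/-- `F` is an invariant (first integral) of the vector field `f`. -/
def IsFirstIntegral {Y Z : Type u} [NormedAddCommGroup Y] [NormedSpace ℝ Y]
    [NormedAddCommGroup Z] [NormedSpace ℝ Z] (F : Y → Z) (f : Y → Y) : Prop :=
  ∀ y, fderiv ℝ F y (f y) = 0

/-- `Φ` preserves `𝓕`-invariants: `F ∘ Φ_f = F` whenever `F ∈ 𝓕(Y, Z)` is an invariant of `f`
(on the right, `F y` is the constant formal series). -/
def PreservesInvariants (𝓕 : MapClass.{u}) (Φ : FormalIntegrator.{u}) : Prop :=
  ∀ (Y Z : Type u) [NormedAddCommGroup Y] [NormedSpace ℝ Y] [CompleteSpace Y]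
    [NormedAddCommGroup Z] [NormedSpace ℝ Z] [CompleteSpace Z] (F : Y → Z), 𝓕 Y Z F →
    ∀ f : Y → Y, ContDiff ℝ ∞ f → IsFirstIntegral F f → ∀ y : Y,
      formalComp F (Φ Y f y) = fun n => if n = 0 then F y else 0

/-- `Φ` is the exact flow with time rescaled by `r`: the series `Y(h) = Φ_{hf}(y)` is the formal
solution of `dY/dh = r f(Y)`, `Y(0) = y`. -/
def IsExactFlow (r : ℝ) (Φ : FormalIntegrator.{u}) : Prop :=
  ∀ (Y : Type u) [NormedAddCommGroup Y] [NormedSpace ℝ Y] [CompleteSpace Y]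
    (f : Y → Y), ContDiff ℝ ∞ f → ∀ y : Y,
      Φ Y f y 0 = y ∧
      ∀ n : ℕ, ((n : ℝ) + 1) • Φ Y f y (n + 1) = r • formalComp f (Φ Y f y) n

/-! ### Runge–Kutta methods and Gauss–Legendre collocation -/

/-- The weight of a tree at stage `i`: `φᵢ(t) = ∏ₘ ∑ⱼ aᵢⱼ φⱼ(tₘ)` over the subtrees `tₘ`. -/
def PlaneTree.stageWeight {s : ℕ} (A : Fin s → Fin s → ℝ) : PlaneTree → Fin s → ℝ
  | .node _ child => fun i => ∏ m, ∑ j, A i j * (child m).stageWeight A j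

theorem PlaneTree.stageWeight_reorder {s : ℕ} (A : Fin s → Fin s → ℝ) {t t' : PlaneTree}
    (h : PlaneTree.Reorder t t') : t.stageWeight A = t'.stageWeight A := by
  induction h with
  | perm k child e =>
    funext i
    exact (Equiv.prod_comp e fun m => ∑ j, A i j * (child m).stageWeight A j).symm
  | sub k child i t _ ih =>
    funext l
    simp only [PlaneTree.stageWeight]
    refine Finset.prod_congr rfl fun m _ => ?_
    by_cases hm : m = i
    · subst hm; simp [ih]
    · simp [Function.update_of_ne hm]

/-- The elementary weights `φ(τ) = ∑ᵢ bᵢ φᵢ(τ)`, the B-series coefficients of the Runge–Kutta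
method with tableau `(A, b)`. -/
def rkWeight {s : ℕ} (A : Fin s → Fin s → ℝ) (b : Fin s → ℝ) : ButcherTree → ℝ :=
  Quot.lift (fun t : PlaneTree => ∑ i, b i * t.stageWeight A i) fun _ _ h => by
    simp only [PlaneTree.stageWeight_reorder A h]

/-- `y₁` results from `y₀` by a Runge–Kutta step (unit step size) for the vector field `f`. -/
def RKStep {s : ℕ} (A : Fin s → Fin s → ℝ) (b : Fin s → ℝ) {Y : Type u} [NormedAddCommGroup Y]
    [NormedSpace ℝ Y] (f : Y → Y) (y₀ y₁ : Y) : Prop :=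
  ∃ S : Fin s → Y, (∀ i, S i = y₀ + ∑ j, A i j • f (S j)) ∧ y₁ = y₀ + ∑ i, b i • f (S i)

/-- `c` lists the `s` roots of the shifted Legendre polynomial of degree `s` on `[0, 1]`. -/
def IsGaussNodes {s : ℕ} (c : Fin s → ℝ) : Prop :=
  Function.Injective c ∧ ∀ i, Polynomial.aeval (c i) (Polynomial.shiftedLegendre s) = 0

/-- The matrix `aᵢⱼ = ∫₀^{cᵢ} ℓⱼ` of the collocation method with nodes `c`, where `ℓⱼ` are the
Lagrange basis polynomials. -/
def collocationMatrix {s : ℕ} (c : Fin s → ℝ) (i j : Fin s) : ℝ :=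
  ∫ x in (0 : ℝ)..c i, (Lagrange.basis Finset.univ c j).eval x

/-- The weights `bⱼ = ∫₀¹ ℓⱼ` of the collocation method with nodes `c`. -/
def collocationWeights {s : ℕ} (c : Fin s → ℝ) (j : Fin s) : ℝ :=
  ∫ x in (0 : ℝ)..1, (Lagrange.basis Finset.univ c j).eval x

end

/-! Composition is the common tool. Expanding `G ∘ Φ` by Taylor's formula and multilinearity gives a
series over plane trees with `G` at the root, whose weights are the products of the weights of the
root subtrees (`formalComp_treeSeries`). Identities of formal series are obtained from remainder
estimates `O(h ^ (n + 1))`.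

The projection to `Y` maps the augmented field `g` to `f`, so the `Y`-component of the series for
`g` is the series for `f`. The field `g` does not depend on `z`, so the `Z`-component is a tree
series with `F' f` at the root. If `F` is affine, then `F'` is constant and (a) follows. If `F` is
quadratic, then `z - F y` is a quadratic invariant of `g`; its preservation is (b).

Gauss methods satisfy `bᵢ aᵢⱼ + bⱼ aⱼᵢ = bᵢ bⱼ`: integrate by parts the product of the
antiderivatives of two Lagrange polynomials, using quadrature that is exact below degree `2 s`.
Under this condition a quadratic `F` satisfies an exact increment identity
(`quadratic_rk_increment`), which serves both the actual steps and the truncated series.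

For (c), take a polynomial field with one coordinate per tree, whose component at `[t₁, …, tₖ]` is
the product of the coordinates of the `tᵢ`. Started at `0`, the B-series has `a(t) h^|t|` as its
coordinate at `t`. Equivariance for products of two and of three coordinates gives two functional
equations for `a`. These imply the equations for all products (`prod_eq_sum_graftAll`), hence `|t|
a(t) = a(•) ∏ a(tᵢ)` with `•` the one-vertex tree (`order_mul_eq`). This recursion characterizes the
exact flow with time rescaled by `a(•)`. -/

noncomputable section

/-! ### Jets of smooth maps -/

section Jets

open Asymptotics Filter Topology

variable {E F : Type*} [NormedAddCommGroup E] [NormedSpace ℝ E]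
  [NormedAddCommGroup F] [NormedSpace ℝ F]

theorem eq_zero_of_pow_smul_isLittleO {n : ℕ} {c : E}
    (h : (fun x : ℝ => x ^ n • c) =o[𝓝 0] fun x : ℝ => x ^ n) : c = 0 := by
  by_contra hc
  have hpos : 0 < ‖c‖ / 2 := by positivity
  have h1 := h.def hpos
  obtain ⟨ε, hε, hb⟩ := Metric.eventually_nhds_iff.1 h1
  have h2 : ‖(ε / 2) ^ n • c‖ ≤ ‖c‖ / 2 * ‖(ε / 2) ^ n‖ := hb (y := ε / 2) (by
    rw [dist_zero_right, Real.norm_eq_abs, abs_of_pos (by positivity)]; linarith)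
  rw [norm_smul] at h2
  have : 0 < ‖(ε / 2) ^ n‖ := by
    rw [norm_pos_iff]; positivity
  nlinarith

/-- If all derivatives below order `k` vanish, the Taylor polynomial of order `k` is its leading
term, and that term is `o(x ^ k)`. -/
theorem iteratedDeriv_eq_zero_of_isBigO {u : ℝ → E} (hu : ContDiff ℝ ∞ u) {n : ℕ}
    (h : u =O[𝓝 0] fun x : ℝ => x ^ (n + 1)) {k : ℕ} (hk : k ≤ n) : iteratedDeriv k u 0 = 0 := by
  induction k using Nat.strong_induction_on with
  | _ k ih =>
    have h1 : (fun x => u x - taylorWithinEval u k Set.univ 0 x) =o[𝓝 0]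
        fun x : ℝ => (x - 0) ^ k :=
      taylor_isLittleO_univ (hu.of_le (by exact_mod_cast le_top))
    have h2 : u =o[𝓝 0] fun x : ℝ => x ^ k :=
      h.trans_isLittleO (isLittleO_pow_pow (by omega))
    have h3 : ∀ x, taylorWithinEval u k Set.univ 0 x = x ^ k • ((k ! : ℝ)⁻¹ • iteratedDeriv k u 0) := by
      intro x
      rw [taylor_within_apply, Finset.sum_range_succ, Finset.sum_eq_zero, zero_add, smul_smul,
        iteratedDerivWithin_univ]
      · simp [mul_comm]
      · intro j hj
        rw [Finset.mem_range] at hj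
        rw [iteratedDerivWithin_univ, ih j hj (by omega), smul_zero]
    have h4 : (fun x : ℝ => x ^ k • ((k ! : ℝ)⁻¹ • iteratedDeriv k u 0)) =o[𝓝 0]
        fun x : ℝ => x ^ k := by
      refine (h2.sub (by simpa using h1)).congr_left fun x => ?_
      rw [← h3]; abel
    have h5 := eq_zero_of_pow_smul_isLittleO h4
    have h6 : ((k ! : ℝ)⁻¹) ≠ 0 := by positivity
    exact (smul_eq_zero.1 h5).resolve_left h6

theorem iteratedDeriv_sum_pow_smul (d : ℕ → E) {n N : ℕ} (hn : n < N) :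
    iteratedDeriv n (fun h : ℝ => ∑ i ∈ Finset.range N, h ^ i • d i) 0 = (n ! : ℝ) • d n := by
  rw [iteratedDeriv_fun_sum (fun i _ => by fun_prop)]
  have : ∀ i, iteratedDeriv n (fun h : ℝ => h ^ i • d i) 0 = (if n = i then (n ! : ℝ) else 0) • d i := by
    intro i
    have h1 := (((ContinuousLinearMap.id ℝ ℝ).smulRight (d i)).iteratedFDeriv_comp_left
      (f := fun h : ℝ => h ^ i) (x := 0) (n := n) (i := n) (by fun_prop) le_rfl)
    have h2 : (fun h : ℝ => h ^ i • d i) =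
      ((ContinuousLinearMap.id ℝ ℝ).smulRight (d i)) ∘ (fun h : ℝ => h ^ i) := by
      ext h; simp
    rw [h2, iteratedDeriv_eq_iteratedFDeriv, h1]
    simp only [ContinuousLinearMap.compContinuousMultilinearMap_coe, Function.comp_apply,
      ← iteratedDeriv_eq_iteratedFDeriv, iteratedDeriv_fun_pow_zero]
    split_ifs with h <;> simp [h]
  simp only [this]
  rw [Finset.sum_eq_single n]
  · simp
  · intro i _ hi; simp [Ne.symm hi]
  · intro h; simp at h; omega

/-- Taylor's formula, with a remainder bounded by a power of the increment. -/
theorem taylor_remainder_isBigO [CompleteSpace F] {G : E → F} (hG : ContDiff ℝ ∞ G) (y : E)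
    (N : ℕ) : (fun v : E => G (y + v) - ∑ k ∈ Finset.range (N + 1),
      (k ! : ℝ)⁻¹ • iteratedFDeriv ℝ k G y fun _ => v) =O[𝓝 0] fun v => ‖v‖ ^ (N + 1) := by
  have hcont : Continuous (iteratedFDeriv ℝ (N + 1) G) :=
    hG.continuous_iteratedFDeriv (by exact_mod_cast le_top)
  obtain ⟨ε, hε, hb⟩ := Metric.continuousAt_iff.1 (hcont.continuousAt (x := y)) 1 one_pos
  set C := ‖iteratedFDeriv ℝ (N + 1) G y‖ + 1
  refine IsBigO.of_bound C ?_
  filter_upwards [Metric.ball_mem_nhds (0 : E) hε] with v hv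
  rw [map_add_eq_sum_add_integral_iteratedFDeriv (n := N)
    (fun t _ => (hG.of_le (by exact_mod_cast le_top)).contDiffAt), add_sub_cancel_left, norm_smul]
  have hv' : ‖v‖ < ε := by simpa using hv
  have h1 : ‖∫ t in (0 : ℝ)..1, (1 - t) ^ N • iteratedFDeriv ℝ (N + 1) G (y + t • v) fun _ => v‖
      ≤ (C * ‖v‖ ^ (N + 1)) * |1 - 0| := by
    refine intervalIntegral.norm_integral_le_of_norm_le_const fun t ht => ?_
    rw [Set.uIoc_of_le zero_le_one] at ht
    have ht1 : |1 - t| ≤ 1 := by rw [abs_le]; constructor <;> linarith [ht.1, ht.2]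
    have h2 : ‖iteratedFDeriv ℝ (N + 1) G (y + t • v)‖ ≤ C := by
      have := hb (x := y + t • v) (by
        rw [dist_eq_norm, add_sub_cancel_left, norm_smul, Real.norm_eq_abs, abs_of_pos ht.1]
        nlinarith [ht.2, norm_nonneg v])
      rw [dist_eq_norm] at this
      have h3 := norm_sub_norm_le (iteratedFDeriv ℝ (N + 1) G (y + t • v))
        (iteratedFDeriv ℝ (N + 1) G y)
      simp only [C]; linarith
    rw [norm_smul, norm_pow, Real.norm_eq_abs]
    have h4 := (iteratedFDeriv ℝ (N + 1) G (y + t • v)).le_opNorm fun _ => v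
    simp only [Finset.prod_const, Finset.card_univ, Fintype.card_fin] at h4
    calc _ ≤ 1 * ‖iteratedFDeriv ℝ (N + 1) G (y + t • v) fun _ => v‖ := by
            gcongr; exact pow_le_one₀ (abs_nonneg _) ht1
      _ ≤ _ := by rw [one_mul]; exact h4.trans (by gcongr)
  have h5 : ‖((N ! : ℝ)⁻¹)‖ ≤ 1 := by
    rw [norm_inv]
    apply inv_le_one_of_one_le₀
    simpa using Nat.one_le_iff_ne_zero.2 (Nat.factorial_ne_zero N)
  calc _ ≤ 1 * ((C * ‖v‖ ^ (N + 1)) * |1 - 0|) := by gcongr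
    _ = _ := by simp

end Jets

/-! ### Tree series and their composition with smooth maps -/

namespace PlaneTree

theorem mem_ofOrder {n : ℕ} {t : PlaneTree} : t ∈ ofOrder n ↔ t.order = n := by
  simp [ofOrder]

theorem order_pos (t : PlaneTree) : 0 < t.order := by
  cases t; simp only [order]; omega

theorem order_child_lt {k : ℕ} (c : Fin k → PlaneTree) (i : Fin k) :
    (c i).order < (node k c).order := by
  have : (c i).order ≤ ∑ i, (c i).order :=
    Finset.single_le_sum (f := fun i => (c i).order) (fun _ _ => Nat.zero_le _) (Finset.mem_univ i)
  simp only [order]; omega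

theorem card_children_lt {k : ℕ} (c : Fin k → PlaneTree) : k < (node k c).order := by
  have : k ≤ ∑ i, (c i).order := by
    calc k = ∑ _i : Fin k, 1 := by simp
      _ ≤ _ := Finset.sum_le_sum fun i _ => (c i).order_pos
  simp only [order]; omega

/-- The plane trees with at most `N` vertices. -/
def ofOrderLE (N : ℕ) : Finset PlaneTree :=
  ((Set.finite_Iic N).biUnion fun n _ => finite_order_eq n).toFinset

theorem mem_ofOrderLE {N : ℕ} {t : PlaneTree} : t ∈ ofOrderLE N ↔ t.order ≤ N := by
  simp [ofOrderLE]

theorem sum_range_sum_ofOrder {M : Type*} [AddCommMonoid M] (g : PlaneTree → M) (N : ℕ) :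
    ∑ n ∈ Finset.range N, ∑ t ∈ ofOrder (n + 1), g t = ∑ t ∈ ofOrderLE N, g t := by
  rw [← Finset.sum_fiberwise_of_maps_to (s := ofOrderLE N) (t := Finset.range N)
    (g := fun t => t.order - 1)]
  · refine Finset.sum_congr rfl fun n hn => Finset.sum_congr ?_ fun _ _ => rfl
    ext t
    have := t.order_pos
    rw [Finset.mem_range] at hn
    rw [mem_ofOrder, Finset.mem_filter, mem_ofOrderLE]
    omega
  · intro t ht
    have := t.order_pos
    rw [mem_ofOrderLE] at ht
    rw [Finset.mem_range]; omega

/-- The product of the weights of the subtrees at the root. -/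
def childWeight (w : PlaneTree → ℝ) : PlaneTree → ℝ
  | node _ c => ∏ i, w (c i)

variable {Y Z W : Type*} [NormedAddCommGroup Y] [NormedSpace ℝ Y]
  [NormedAddCommGroup Z] [NormedSpace ℝ Z] [NormedAddCommGroup W] [NormedSpace ℝ W]

/-- The elementary differential with the map `G` in place of the vector field at the root. -/
def rootDifferential (f : Y → Y) (G : Y → Z) (y : Y) : PlaneTree → Z
  | node k c => iteratedFDeriv ℝ k G y fun i => (c i).elementaryDifferential f y

theorem elementaryDifferential_eq (f : Y → Y) (t : PlaneTree) (y : Y) :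
    t.elementaryDifferential f y = rootDifferential f f y t := by
  cases t; rfl

theorem rootDifferential_clm_comp {f : Y → Y} {G : Y → Z} (hG : ContDiff ℝ ∞ G) (A : Z →L[ℝ] W)
    (y : Y) (t : PlaneTree) :
    rootDifferential f (fun x => A (G x)) y t = A (rootDifferential f G y t) := by
  cases t with
  | node k c =>
    have := A.iteratedFDeriv_comp_left (f := G) (x := y) (n := k) (i := k)
      (hG.of_le (by exact_mod_cast le_top)).contDiffAt le_rfl
    simp only [rootDifferential]
    change iteratedFDeriv ℝ k (A ∘ G) y _ = _
    rw [this]; rfl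

/-- Elementary differentials of vector fields related by a linear map are related. -/
theorem map_elementaryDifferential {f : Y → Y} {g : Z → Z} (hf : ContDiff ℝ ∞ f)
    (hg : ContDiff ℝ ∞ g) (P : Y →L[ℝ] Z) (h : ∀ y, P (f y) = g (P y)) (y : Y) (t : PlaneTree) :
    P (t.elementaryDifferential f y) = t.elementaryDifferential g (P y) := by
  induction t with
  | node k c ih =>
    rw [elementaryDifferential_eq, ← rootDifferential_clm_comp hf, elementaryDifferential_eq]
    simp only [rootDifferential, h]
    have := P.iteratedFDeriv_comp_right (f := g) (n := k) (i := k)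
      (hg.of_le (by exact_mod_cast le_top)) y le_rfl
    change iteratedFDeriv ℝ k (g ∘ P) y _ = _
    rw [this]
    simp [ih]

theorem rootDifferential_comp_clm {f : Y → Y} {g : Z → Z} (hf : ContDiff ℝ ∞ f)
    (hg : ContDiff ℝ ∞ g) (P : Y →L[ℝ] Z) (h : ∀ y, P (f y) = g (P y)) {G : Z → W}
    (hG : ContDiff ℝ ∞ G) (y : Y) (t : PlaneTree) :
    rootDifferential f (fun x => G (P x)) y t = rootDifferential g G (P y) t := by
  cases t with
  | node k c =>
    simp only [rootDifferential]
    have := P.iteratedFDeriv_comp_right (f := G) (n := k) (i := k)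
      (hG.of_le (by exact_mod_cast le_top)) y le_rfl
    change iteratedFDeriv ℝ k (G ∘ P) y _ = _
    rw [this]
    simp [map_elementaryDifferential hf hg P h]

end PlaneTree

open PlaneTree Asymptotics Filter Topology

variable {Y Z W : Type*} [NormedAddCommGroup Y] [NormedSpace ℝ Y]
  [NormedAddCommGroup Z] [NormedSpace ℝ Z] [NormedAddCommGroup W] [NormedSpace ℝ W]

/-- The series `y + ∑ₜ h^{|t|} w(t) F(t)(y)` over plane trees, suitably normalized. -/
def treeSeries (f : Y → Y) (y : Y) (w : PlaneTree → ℝ) (n : ℕ) : Y :=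
  if n = 0 then y else ∑ t ∈ ofOrder n, (w t / t.branchFactorial) • t.elementaryDifferential f y

theorem bSeries_eq_treeSeries {Y : Type u} [NormedAddCommGroup Y] [NormedSpace ℝ Y]
    (a : ButcherTree → ℝ) (f : Y → Y) (y : Y) :
    bSeries a Y f y = treeSeries f y fun t => a t.toRooted := rfl

@[simp] theorem treeSeries_zero (f : Y → Y) (y : Y) (w : PlaneTree → ℝ) :
    treeSeries f y w 0 = y := if_pos rfl

/-- The series of the values of `G` along the tree series with weights `w`. -/
def rootSeries (f : Y → Y) (G : Y → Z) (y : Y) (w : PlaneTree → ℝ) (n : ℕ) : Z :=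
  ∑ t ∈ ofOrder (n + 1), (childWeight w t / t.branchFactorial) • rootDifferential f G y t

theorem sum_treeSeries (f : Y → Y) (y : Y) (w : PlaneTree → ℝ) (N : ℕ) (h : ℝ) :
    ∑ i ∈ Finset.range (N + 1), h ^ i • treeSeries f y w i =
      y + ∑ t ∈ ofOrderLE N, h ^ t.order •
        ((w t / t.branchFactorial) • t.elementaryDifferential f y) := by
  rw [Finset.sum_range_succ', add_comm, pow_zero, one_smul, treeSeries_zero,
    ← sum_range_sum_ofOrder]
  congr 1
  refine Finset.sum_congr rfl fun n _ => ?_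
  rw [treeSeries, if_neg n.succ_ne_zero, Finset.smul_sum]
  refine Finset.sum_congr rfl fun t ht => ?_
  rw [mem_ofOrder.1 ht]

theorem sum_rootSeries (f : Y → Y) (G : Y → Z) (y : Y) (w : PlaneTree → ℝ) (N : ℕ) (h : ℝ) :
    ∑ i ∈ Finset.range (N + 1), h ^ i • rootSeries f G y w i =
      ∑ t ∈ ofOrderLE (N + 1), h ^ (t.order - 1) •
        ((childWeight w t / t.branchFactorial) • rootDifferential f G y t) := by
  rw [← sum_range_sum_ofOrder]
  refine Finset.sum_congr rfl fun n _ => ?_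
  rw [rootSeries, Finset.smul_sum]
  refine Finset.sum_congr rfl fun t ht => ?_
  rw [mem_ofOrder.1 ht, Nat.add_sub_cancel]

/-- Trees with at most `N` subtrees at the root, each with at most `N` vertices. -/
def treesWithChildrenLE (N : ℕ) : Finset PlaneTree :=
  open Classical in
  ((Finset.range (N + 1)).sigma fun k => Fintype.piFinset fun _ : Fin k => ofOrderLE N).image
    fun p => node p.1 p.2

theorem ofOrderLE_succ_subset (N : ℕ) : ofOrderLE (N + 1) ⊆ treesWithChildrenLE N := by
  intro t ht
  rw [mem_ofOrderLE] at ht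
  cases t with
  | node k c =>
    simp only [treesWithChildrenLE, Finset.mem_image, Finset.mem_sigma, Finset.mem_range,
      Fintype.mem_piFinset, mem_ofOrderLE]
    refine ⟨⟨k, c⟩, ⟨?_, fun i => ?_⟩, rfl⟩
    · have := card_children_lt c
      simp only; omega
    · have := order_child_lt c i
      simp only; omega

/-- Multilinearity expands the `k`-th derivative over ordered `k`-tuples of trees, that is, over
plane trees with `k` root subtrees, and `1 / k!` is the root's share of `branchFactorial`. Working
with plane trees avoids any counting of automorphisms. -/
theorem sum_taylor_eq (f : Y → Y) (G : Y → Z) (y : Y) (w : PlaneTree → ℝ) (N : ℕ) (h : ℝ) :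
    (∑ k ∈ Finset.range (N + 1), (k ! : ℝ)⁻¹ • iteratedFDeriv ℝ k G y fun _ =>
      ∑ t ∈ ofOrderLE N, h ^ t.order •
        ((w t / t.branchFactorial) • t.elementaryDifferential f y)) =
      ∑ t ∈ treesWithChildrenLE N, h ^ (t.order - 1) •
        ((childWeight w t / t.branchFactorial) • rootDifferential f G y t) := by
  classical
  rw [treesWithChildrenLE, Finset.sum_image, Finset.sum_sigma]
  · refine Finset.sum_congr rfl fun k _ => ?_
    rw [ContinuousMultilinearMap.map_sum_finset, Finset.smul_sum]
    refine Finset.sum_congr rfl fun c _ => ?_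
    simp only [smul_smul]
    rw [ContinuousMultilinearMap.map_smul_univ, smul_smul]
    simp only [rootDifferential, childWeight, order, branchFactorial, Nat.add_sub_cancel_left]
    congr 1
    rw [Finset.prod_mul_distrib, Finset.prod_pow_eq_pow_sum, Finset.prod_div_distrib]
    push_cast
    rw [div_mul_eq_div_div]
    ring
  · rintro ⟨k, c⟩ _ ⟨k', c'⟩ _ h
    simp only [node.injEq] at h
    obtain ⟨rfl, h⟩ := h
    rw [eq_of_heq h]

theorem pow_smul_isBigO {m n : ℕ} (e : Z) (hmn : n ≤ m) :
    (fun h : ℝ => h ^ m • e) =O[𝓝 0] fun h : ℝ => h ^ n := by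
  have h1 : (fun h : ℝ => h ^ m) =O[𝓝 0] fun h : ℝ => h ^ n := by
    refine IsBigO.of_bound 1 ?_
    filter_upwards [Metric.ball_mem_nhds (0 : ℝ) one_pos] with h hh
    rw [norm_pow, norm_pow, one_mul]
    exact pow_le_pow_of_le_one (norm_nonneg _) (le_of_lt (by simpa using hh)) hmn
  simpa using h1.smul (isBigO_refl (fun _ : ℝ => e) (𝓝 0)) |>.trans
    (IsBigO.of_bound ‖e‖ (Eventually.of_forall fun h => by
      rw [norm_smul, mul_comm]) : (fun h : ℝ => h ^ n • e) =O[𝓝 0] fun h : ℝ => h ^ n)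

/-- Two errors occur: the Taylor remainder at an increment of size `O(h)`, and the trees with more
than `N + 1` vertices created by expanding the Taylor polynomial. The root carries `G` and no factor
`h`, so such trees have exponent at least `N + 1`. -/
theorem comp_treeSeries_isBigO [CompleteSpace Z] (f : Y → Y) {G : Y → Z} (hG : ContDiff ℝ ∞ G)
    (y : Y) (w : PlaneTree → ℝ) (N : ℕ) :
    (fun h : ℝ => G (∑ i ∈ Finset.range (N + 1), h ^ i • treeSeries f y w i) -
      ∑ i ∈ Finset.range (N + 1), h ^ i • rootSeries f G y w i) =O[𝓝 0]
        fun h : ℝ => h ^ (N + 1) := by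
  classical
  set v : ℝ → Y := fun h => ∑ t ∈ ofOrderLE N, h ^ t.order •
    ((w t / t.branchFactorial) • t.elementaryDifferential f y) with hv
  have hvc : Continuous v := by fun_prop
  have hv0 : v 0 = 0 := by
    simp only [hv]
    refine Finset.sum_eq_zero fun t _ => ?_
    rw [zero_pow t.order_pos.ne', zero_smul]
  have hvO : (fun h => ‖v h‖ ^ (N + 1)) =O[𝓝 0] fun h : ℝ => h ^ (N + 1) := by
    refine IsBigO.pow (IsBigO.norm_left ?_) _
    have hd : DifferentiableAt ℝ v 0 := by fun_prop
    simpa [hv0] using hd.isBigO_sub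
  have h1 := ((taylor_remainder_isBigO hG y N).comp_tendsto
    (show Tendsto v (𝓝 0) (𝓝 0) by simpa [hv0] using hvc.tendsto 0)).trans hvO
  have h2 : (fun h : ℝ => ∑ t ∈ treesWithChildrenLE N \ ofOrderLE (N + 1), h ^ (t.order - 1) •
      ((childWeight w t / t.branchFactorial) • rootDifferential f G y t)) =O[𝓝 0]
        fun h : ℝ => h ^ (N + 1) := by
    refine IsBigO.fun_sum fun t ht => pow_smul_isBigO _ ?_
    rw [Finset.mem_sdiff, mem_ofOrderLE] at ht
    omega
  refine (h1.add h2).congr_left fun h => ?_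
  simp only [Function.comp_apply]
  have hs := sum_taylor_eq f G y w N h
  rw [← Finset.sum_sdiff (ofOrderLE_succ_subset N)] at hs
  rw [sum_treeSeries, sum_rootSeries, hs]
  abel

theorem coeff_eq_of_isBigO {G : ℝ → Z} {d d' : ℕ → Z} {n : ℕ}
    (h : (fun h : ℝ => G h - ∑ i ∈ Finset.range (n + 1), h ^ i • d i) =O[𝓝 0]
      fun h : ℝ => h ^ (n + 1))
    (h' : (fun h : ℝ => G h - ∑ i ∈ Finset.range (n + 1), h ^ i • d' i) =O[𝓝 0]
      fun h : ℝ => h ^ (n + 1)) : d n = d' n := by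
  have h1 : (fun h : ℝ => ∑ i ∈ Finset.range (n + 1), h ^ i • (d i - d' i)) =O[𝓝 0]
      fun h : ℝ => h ^ (n + 1) := by
    refine (h'.sub h).congr_left fun x => ?_
    simp only [smul_sub, Finset.sum_sub_distrib]
    abel
  have h2 := iteratedDeriv_eq_zero_of_isBigO (by fun_prop) h1 le_rfl
  rw [iteratedDeriv_sum_pow_smul _ n.lt_succ_self] at h2
  exact sub_eq_zero.1 ((smul_eq_zero.1 h2).resolve_left (by positivity))

variable {Y Z W : Type u} [NormedAddCommGroup Y] [NormedSpace ℝ Y]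
  [NormedAddCommGroup Z] [NormedSpace ℝ Z] [NormedAddCommGroup W] [NormedSpace ℝ W]

theorem formalComp_eq_of_isBigO {G : Y → Z} (hG : ContDiff ℝ ∞ G) {c : ℕ → Y} {d : ℕ → Z} {n : ℕ}
    (h : (fun h : ℝ => G (∑ i ∈ Finset.range (n + 1), h ^ i • c i) -
      ∑ i ∈ Finset.range (n + 1), h ^ i • d i) =O[𝓝 0] fun h : ℝ => h ^ (n + 1)) :
    formalComp G c n = d n := by
  have h1 : ContDiff ℝ ∞ fun h : ℝ => G (∑ i ∈ Finset.range (n + 1), h ^ i • c i) :=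
    hG.comp (by fun_prop)
  have h2 : ContDiff ℝ ∞ fun h : ℝ => ∑ i ∈ Finset.range (n + 1), h ^ i • d i := by fun_prop
  have h3 := iteratedDeriv_eq_zero_of_isBigO (h1.sub h2) h le_rfl
  rw [iteratedDeriv_fun_sub (h1.of_le (by exact_mod_cast le_top)).contDiffAt
    (h2.of_le (by exact_mod_cast le_top)).contDiffAt, sub_eq_zero,
    iteratedDeriv_sum_pow_smul _ n.lt_succ_self] at h3
  rw [formalComp, h3, inv_smul_smul₀]
  positivity

theorem formalComp_eq_of_eq {G : Y → Z} (hG : ContDiff ℝ ∞ G) {c : ℕ → Y} {d : ℕ → Z} {n : ℕ}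
    (h : ∀ h : ℝ, G (∑ i ∈ Finset.range (n + 1), h ^ i • c i) =
      ∑ i ∈ Finset.range (n + 1), h ^ i • d i) :
    formalComp G c n = d n := by
  refine formalComp_eq_of_isBigO hG ?_
  simp only [h, sub_self]
  exact isBigO_zero _ _

theorem formalComp_treeSeries [CompleteSpace Z] (f : Y → Y) {G : Y → Z} (hG : ContDiff ℝ ∞ G)
    (y : Y) (w : PlaneTree → ℝ) (n : ℕ) :
    formalComp G (treeSeries f y w) n = rootSeries f G y w n :=
  formalComp_eq_of_isBigO hG (comp_treeSeries_isBigO f hG y w n)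

/-! ### Affine and quadratic equivariance -/

theorem formalComp_clm_comp {G : Y → Z} (hG : ContDiff ℝ ∞ G) (A : Z →L[ℝ] W) (c : ℕ → Y) (n : ℕ) :
    formalComp (fun x => A (G x)) c n = A (formalComp G c n) := by
  have h1 : ContDiff ℝ ∞ fun h : ℝ => G (∑ i ∈ Finset.range (n + 1), h ^ i • c i) :=
    hG.comp (by fun_prop)
  have h2 := A.iteratedFDeriv_comp_left (x := 0) (n := n) (i := n)
    (h1.of_le (by exact_mod_cast le_top)).contDiffAt le_rfl
  simp only [formalComp, iteratedDeriv_eq_iteratedFDeriv, map_smul]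
  congr 1
  exact congrArg (fun M => M fun _ => 1) h2

theorem formalComp_id (c : ℕ → Y) (n : ℕ) : formalComp (fun x => x) c n = c n :=
  formalComp_eq_of_eq contDiff_fun_id fun _ => rfl

theorem formalComp_graph {F : Y → Z} (hF : ContDiff ℝ ∞ F) (c : ℕ → Y) (n : ℕ) :
    formalComp (fun x => (x, F x)) c n = (c n, formalComp F c n) := by
  have h := contDiff_fun_id.prodMk hF
  refine Prod.ext ?_ ?_
  · have := formalComp_clm_comp h (ContinuousLinearMap.fst ℝ Y Z) c n
    exact this.symm.trans (formalComp_id c n)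
  · exact (formalComp_clm_comp h (ContinuousLinearMap.snd ℝ Y Z) c n).symm

theorem contDiff_fderiv_apply {F : Y → Z} {f : Y → Y} (hF : ContDiff ℝ ∞ F) (hf : ContDiff ℝ ∞ f) :
    ContDiff ℝ ∞ fun x => fderiv ℝ F x (f x) :=
  (hF.fderiv_right (m := ∞) (by simp)).clm_apply hf

theorem contDiff_augmentedField {F : Y → Z} {f : Y → Y} (hF : ContDiff ℝ ∞ F)
    (hf : ContDiff ℝ ∞ f) : ContDiff ℝ ∞ (augmentedField F f) :=
  (hf.comp contDiff_fst).prodMk ((contDiff_fderiv_apply hF hf).comp contDiff_fst)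

/-- The projection to `Y` intertwines `g` and `f`, and elementary differentials respect linear
relations between fields. -/
theorem fst_treeSeries_augmentedField {F : Y → Z} {f : Y → Y} (hF : ContDiff ℝ ∞ F)
    (hf : ContDiff ℝ ∞ f) (p : Y × Z) (w : PlaneTree → ℝ) (n : ℕ) :
    (treeSeries (augmentedField F f) p w n).1 = treeSeries f p.1 w n := by
  simp only [treeSeries]
  split_ifs
  · rfl
  · rw [Prod.fst_sum]
    refine Finset.sum_congr rfl fun t _ => ?_
    rw [Prod.smul_fst]
    congr 1
    exact map_elementaryDifferential (contDiff_augmentedField hF hf) hf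
      (ContinuousLinearMap.fst ℝ Y Z) (fun _ => rfl) p t

/-- Since `g` depends on `y` only, the `Z`-direction matters at the root alone; the vertices above
it see just `f`. -/
theorem snd_treeSeries_augmentedField {F : Y → Z} {f : Y → Y} (hF : ContDiff ℝ ∞ F)
    (hf : ContDiff ℝ ∞ f) (p : Y × Z) (w : PlaneTree → ℝ) {n : ℕ} (hn : n ≠ 0) :
    (treeSeries (augmentedField F f) p w n).2 = ∑ t ∈ ofOrder n, (w t / t.branchFactorial) •
      rootDifferential f (fun x => fderiv ℝ F x (f x)) p.1 t := by
  simp only [treeSeries, if_neg hn]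
  rw [Prod.snd_sum]
  refine Finset.sum_congr rfl fun t _ => ?_
  rw [Prod.smul_snd]
  congr 1
  have hg := contDiff_augmentedField hF hf
  rw [elementaryDifferential_eq]
  refine (rootDifferential_clm_comp hg (ContinuousLinearMap.snd ℝ Y Z) p t).symm.trans ?_
  exact rootDifferential_comp_clm hg hf (ContinuousLinearMap.fst ℝ Y Z) (fun _ => rfl)
    (contDiff_fderiv_apply hF hf) p t

theorem bSeries_affine_equivariant (a : ButcherTree → ℝ) :
    FunctionallyEquivariant affineMaps.{u} (bSeries a) := by
  rintro Y Z _ _ _ _ _ _ F ⟨A, hA⟩ f hf y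
  have hA' : ∀ x, F x = A.contLinear x + F 0 := fun x => by
    rw [hA, hA]; exact congrFun A.decomp x
  have hF : ContDiff ℝ ∞ F := by
    rw [funext hA']; fun_prop
  have hd : ∀ x, fderiv ℝ F x = A.contLinear := fun x => by
    rw [funext hA', fderiv_add_const]; exact A.contLinear.fderiv
  funext n
  rw [formalComp_graph hF, bSeries_eq_treeSeries, bSeries_eq_treeSeries]
  refine Prod.ext (fst_treeSeries_augmentedField hF hf (y, F y) _ n).symm ?_
  have h1 : formalComp F (treeSeries f y fun t => a t.toRooted) n =
      if n = 0 then F y else A.contLinear (treeSeries f y (fun t => a t.toRooted) n) := by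
    refine formalComp_eq_of_eq (d := fun n => if n = 0 then F y else
      A.contLinear (treeSeries f y (fun t => a t.toRooted) n)) hF fun h => ?_
    rw [hA', Finset.sum_range_succ', Finset.sum_range_succ']
    simp [hA' y, add_assoc]
  simp only [h1]
  split_ifs with hn
  · subst hn; simp
  · rw [snd_treeSeries_augmentedField hF hf _ _ hn, treeSeries, if_neg hn, map_sum]
    refine Finset.sum_congr rfl fun t _ => ?_
    simp only [hd]
    rw [rootDifferential_clm_comp hf, map_smul, elementaryDifferential_eq]

theorem polynomialMaps.contDiff {d : ℕ} {F : Y → Z} (hF : polynomialMaps d Y Z F) :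
    ContDiff ℝ ∞ F := by
  obtain ⟨p, hp⟩ := hF
  rw [funext hp]
  exact ContDiff.sum fun k _ => (p k).contDiff.comp (contDiff_pi.2 fun _ => contDiff_id)

theorem polynomialMaps.snd_sub_comp_fst {d : ℕ} (hd : 1 ≤ d) {F : Y → Z}
    (hF : polynomialMaps d Y Z F) : polynomialMaps d (Y × Z) Z fun p => p.2 - F p.1 := by
  obtain ⟨p, hp⟩ := hF
  let q : (k : ℕ) → ContinuousMultilinearMap ℝ (fun _ : Fin k => Y × Z) Z := fun k =>
    (p k).compContinuousLinearMap fun _ => ContinuousLinearMap.fst ℝ Y Z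
  let l : (k : ℕ) → ContinuousMultilinearMap ℝ (fun _ : Fin k => Y × Z) Z :=
    Function.update 0 1 (ContinuousMultilinearMap.ofSubsingleton ℝ (Y × Z) Z 0
      (ContinuousLinearMap.snd ℝ Y Z))
  refine ⟨fun k => l k - q k, fun x => ?_⟩
  simp only [sub_apply, Finset.sum_sub_distrib]
  congr 1
  · rw [Finset.sum_eq_single 1]
    · simp [l]
    · intro k _ hk; simp [l, hk]
    · intro h; simp at h; omega
  · rw [hp]; rfl

/-- A quadratic map is the sum of a constant, a linear and a bilinear term. -/
theorem quadraticMaps.exists_bilinear {F : Y → Z} (hF : quadraticMaps Y Z F) :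
    ∃ (e : Z) (A : Y →L[ℝ] Z) (B : Y →L[ℝ] Y →L[ℝ] Z), ∀ y, F y = e + A y + B y y := by
  obtain ⟨p, hp⟩ := hF
  refine ⟨p 0 0, continuousMultilinearCurryFin1 ℝ Y Z (p 1),
    ((continuousMultilinearCurryFin1 ℝ Y Z).toContinuousLinearEquiv :
      _ →L[ℝ] (Y →L[ℝ] Z)) ∘L (p 2).curryLeft, fun y => ?_⟩
  have h0 : (p 0 fun _ => y) = p 0 0 := congrArg _ (Subsingleton.elim _ _)
  have h1 : (p 1 fun _ => y) = continuousMultilinearCurryFin1 ℝ Y Z (p 1) y := by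
    rw [continuousMultilinearCurryFin1_apply]
    exact congrArg _ (funext fun i => by fin_cases i; rfl)
  have h2 : (p 2 fun _ => y) = (((continuousMultilinearCurryFin1 ℝ Y Z).toContinuousLinearEquiv :
      _ →L[ℝ] (Y →L[ℝ] Z)) ∘L (p 2).curryLeft) y y := by
    change _ = p 2 _
    exact congrArg _ (funext fun i => by fin_cases i <;> rfl)
  rw [hp, Finset.sum_range_succ, Finset.sum_range_succ, Finset.sum_range_one, h0, h1, h2]

theorem formalComp_snd_sub_comp_fst {F : Y → Z} (hF : ContDiff ℝ ∞ F) (d : ℕ → Y × Z) (n : ℕ) :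
    formalComp (fun p : Y × Z => p.2 - F p.1) d n =
      (d n).2 - formalComp F (fun i => (d i).1) n := by
  have h : ContDiff ℝ ∞ fun p : Y × Z => (p.2, F p.1) :=
    contDiff_snd.prodMk (hF.comp contDiff_fst)
  have h0 := formalComp_clm_comp h
    (ContinuousLinearMap.fst ℝ Z Z - ContinuousLinearMap.snd ℝ Z Z) d n
  have h1 := formalComp_clm_comp h (ContinuousLinearMap.fst ℝ Z Z) d n
  have h2 := formalComp_clm_comp h (ContinuousLinearMap.snd ℝ Z Z) d n
  have h3 := formalComp_clm_comp contDiff_fun_id (ContinuousLinearMap.snd ℝ Y Z) d n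
  rw [formalComp_id] at h3
  have h4 : formalComp (fun p : Y × Z => F p.1) d n = formalComp F (fun i => (d i).1) n := by
    simp [formalComp, Prod.fst_sum]
  rw [← h4]
  refine h0.trans ?_
  rw [sub_apply, ← h1, ← h2]
  congr 1

/-- The function `z - F y` is a quadratic invariant of `g` that vanishes at `(y, F y)`. Its
vanishing along the series for `g` says that the `Z`-component is `F` of the `Y`-component. -/
theorem bSeries_quadratic_equivariant (a : ButcherTree → ℝ)
    (ha : PreservesInvariants quadraticMaps.{u} (bSeries a)) :
    FunctionallyEquivariant quadraticMaps.{u} (bSeries a) := by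
  intro Y Z _ _ _ _ _ _ F hF f hf y
  have hFc := polynomialMaps.contDiff hF
  have hGq : quadraticMaps (Y × Z) Z fun p => p.2 - F p.1 :=
    polynomialMaps.snd_sub_comp_fst one_le_two hF
  have hg := contDiff_augmentedField hFc hf
  have hinv : IsFirstIntegral (fun p : Y × Z => p.2 - F p.1) (augmentedField F f) := by
    intro p
    have h1 : HasFDerivAt (fun p : Y × Z => p.2 - F p.1)
        (ContinuousLinearMap.snd ℝ Y Z - (fderiv ℝ F p.1).comp (ContinuousLinearMap.fst ℝ Y Z)) p :=
      hasFDerivAt_snd.sub (((hFc.differentiable (by simp)) p.1).hasFDerivAt.comp p hasFDerivAt_fst)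
    rw [h1.fderiv]
    simp [augmentedField]
  have h2 := ha (Y × Z) Z _ hGq _ hg hinv (y, F y)
  funext n
  have h3 := congrFun h2 n
  simp only [sub_self, ite_self] at h3
  rw [formalComp_snd_sub_comp_fst hFc, sub_eq_zero, bSeries_eq_treeSeries] at h3
  rw [formalComp_graph hFc, bSeries_eq_treeSeries, bSeries_eq_treeSeries]
  refine Prod.ext (fst_treeSeries_augmentedField hFc hf (y, F y) _ n).symm ?_
  simp only [fst_treeSeries_augmentedField hFc hf] at h3
  exact h3.symm

/-! ### Symplectic Runge–Kutta methods -/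

/-- The identity behind the preservation of quadratic invariants by symplectic Runge–Kutta
methods. It holds for arbitrary increments `k`. -/
theorem quadratic_rk_increment {s : ℕ} {A : Fin s → Fin s → ℝ} {b : Fin s → ℝ}
    (hAb : ∀ i j, b i * A i j + b j * A j i = b i * b j) {F : Y → Z} (hF : quadraticMaps Y Z F)
    (y : Y) (k : Fin s → Y) :
    F (y + ∑ i, b i • k i) = F y + ∑ i, b i • fderiv ℝ F (y + ∑ j, A i j • k j) (k i) := by
  obtain ⟨e, L, B, hF⟩ := hF.exists_bilinear
  have hd : ∀ x v, fderiv ℝ F x v = L v + (B x v + B v x) := by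
    intro x v
    have h1 : HasFDerivAt (fun y => e + L y + B y y) (L + (B.precompR Y x (.id ℝ Y) +
        B.precompL Y (.id ℝ Y) x)) x :=
      (L.hasFDerivAt.const_add e).add
        (B.hasFDerivAt_of_bilinear (hasFDerivAt_id x) (hasFDerivAt_id x))
    rw [funext hF, h1.fderiv]
    simp
  -- The form `B` need not be symmetric. Exchanging the indices in one of the two double sums coming
  -- from `F'` puts the coefficient `bᵢ aᵢⱼ + bⱼ aⱼᵢ` in front of `B (k i) (k j)`.
  have hswap : ∑ i, ∑ j, b i • A i j • B (k j) (k i) = ∑ i, ∑ j, b j • A j i • B (k i) (k j) :=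
    Finset.sum_comm
  have hsym : ∑ i, ∑ j, b i • A i j • B (k i) (k j) + ∑ i, ∑ j, b i • A i j • B (k j) (k i) =
      ∑ i, ∑ j, b i • b j • B (k j) (k i) := by
    rw [Finset.sum_comm (f := fun i j => b i • b j • B (k j) (k i)), hswap, ← Finset.sum_add_distrib]
    refine Finset.sum_congr rfl fun i _ => ?_
    rw [← Finset.sum_add_distrib]
    refine Finset.sum_congr rfl fun j _ => ?_
    rw [smul_smul, smul_smul, smul_smul, ← add_smul, hAb, mul_comm]
  simp only [hd, hF, map_add, map_sum, map_smul, add_apply, sum_apply,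
    smul_apply, smul_add, Finset.sum_add_distrib, Finset.smul_sum]
  rw [← hsym]
  abel

theorem RKStep.apply_eq {s : ℕ} {A : Fin s → Fin s → ℝ} {b : Fin s → ℝ}
    (hAb : ∀ i j, b i * A i j + b j * A j i = b i * b j) {F : Y → Z} (hF : quadraticMaps Y Z F)
    {f : Y → Y} (hf : IsFirstIntegral F f) {y₀ y₁ : Y} (h : RKStep A b f y₀ y₁) :
    F y₁ = F y₀ := by
  obtain ⟨S, hS, rfl⟩ := h
  rw [quadratic_rk_increment hAb hF y₀ fun i => f (S i)]
  simp only [← hS, hf _, smul_zero, Finset.sum_const_zero, add_zero]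

/-- The `Z`-stages are explicit in the `Y`-stages because `g` does not depend on `z`, so stages for
`f` and for `g` determine each other. The increment identity then shows that the final `z` is `F
y₁`. -/
theorem rkStep_augmentedField_iff {s : ℕ} {A : Fin s → Fin s → ℝ} {b : Fin s → ℝ}
    (hAb : ∀ i j, b i * A i j + b j * A j i = b i * b j) {F : Y → Z} (hF : quadraticMaps Y Z F)
    (f : Y → Y) (y₀ : Y) (p : Y × Z) :
    RKStep A b (augmentedField F f) (y₀, F y₀) p ↔ ∃ y₁ : Y, RKStep A b f y₀ y₁ ∧ p = (y₁, F y₁) := by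
  constructor
  · rintro ⟨S, hS, rfl⟩
    have hS' : ∀ i, (S i).1 = y₀ + ∑ j, A i j • f (S j).1 := fun i => by
      conv_lhs => rw [hS i]
      simp [augmentedField, Prod.fst_sum]
    refine ⟨_, ⟨fun i => (S i).1, hS', rfl⟩, ?_⟩
    rw [quadratic_rk_increment hAb hF y₀ fun i => f (S i).1]
    simp only [← hS']
    refine Prod.ext ?_ ?_ <;> simp [augmentedField, Prod.fst_sum, Prod.snd_sum]
  · rintro ⟨y₁, ⟨S, hS, rfl⟩, rfl⟩
    refine ⟨fun i => (S i, F y₀ + ∑ j, A i j • fderiv ℝ F (S j) (f (S j))), fun i => ?_, ?_⟩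
    · refine Prod.ext ?_ ?_
      · simpa [augmentedField, Prod.fst_sum] using hS i
      · simp [augmentedField, Prod.snd_sum]
    · rw [quadratic_rk_increment hAb hF y₀ fun i => f (S i)]
      simp only [← hS]
      refine Prod.ext ?_ ?_ <;> simp [augmentedField, Prod.fst_sum, Prod.snd_sum]

/-! ### B-series of Runge–Kutta methods -/

theorem childWeight_rk {s : ℕ} (A : Fin s → Fin s → ℝ) (i : Fin s) (t : PlaneTree) :
    childWeight (fun t => ∑ j, A i j * t.stageWeight A j) t = t.stageWeight A i := by
  cases t; rfl

/-- The series of the stage derivatives of a Runge–Kutta method. -/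
def stageSeries {s : ℕ} (A : Fin s → Fin s → ℝ) (f : Y → Y) (y : Y) (i : Fin s) (n : ℕ) : Y :=
  ∑ t ∈ ofOrder (n + 1), (t.stageWeight A i / t.branchFactorial) • t.elementaryDifferential f y

theorem rootSeries_rk {s : ℕ} (A : Fin s → Fin s → ℝ) (f : Y → Y) (y : Y) (i : Fin s) (n : ℕ) :
    rootSeries f f y (fun t => ∑ j, A i j * t.stageWeight A j) n = stageSeries A f y i n := by
  simp only [rootSeries, stageSeries, childWeight_rk, elementaryDifferential_eq]

theorem treeSeries_succ_rk {s : ℕ} (A : Fin s → Fin s → ℝ) (b : Fin s → ℝ) (f : Y → Y) (y : Y)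
    (n : ℕ) : treeSeries f y (fun t => ∑ j, b j * t.stageWeight A j) (n + 1) =
      ∑ j, b j • stageSeries A f y j n := by
  simp only [treeSeries, if_neg n.succ_ne_zero, stageSeries, Finset.smul_sum]
  rw [Finset.sum_comm]
  refine Finset.sum_congr rfl fun t _ => ?_
  rw [Finset.sum_div, Finset.sum_smul]
  refine Finset.sum_congr rfl fun j _ => ?_
  rw [smul_smul, mul_div_assoc]

theorem sum_treeSeries_rk {s : ℕ} (A : Fin s → Fin s → ℝ) (b : Fin s → ℝ) (f : Y → Y) (y : Y)
    (N : ℕ) (h : ℝ) :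
    ∑ n ∈ Finset.range (N + 1), h ^ n • treeSeries f y (fun t => ∑ j, b j * t.stageWeight A j) n =
      y + ∑ j, b j • h • ∑ n ∈ Finset.range N, h ^ n • stageSeries A f y j n := by
  rw [Finset.sum_range_succ', add_comm, pow_zero, one_smul, treeSeries_zero]
  congr 1
  simp only [treeSeries_succ_rk, Finset.smul_sum]
  rw [Finset.sum_comm]
  refine Finset.sum_congr rfl fun j _ => Finset.sum_congr rfl fun n _ => ?_
  simp only [smul_smul]
  congr 1
  ring

/-- The increment identity holds for arbitrary increments, hence for the truncated stage series `h
κᵢ`. It leaves the terms `bᵢ h F'(Sᵢ) κᵢ = bᵢ h F'(Sᵢ) (κᵢ - f(Sᵢ))`, by invariance, and `κᵢ` agrees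
with `f(Sᵢ)` up to `O(h ^ N)`. -/
theorem bSeries_rk_preservesInvariants {s : ℕ} {A : Fin s → Fin s → ℝ} {b : Fin s → ℝ}
    (hAb : ∀ i j, b i * A i j + b j * A j i = b i * b j) :
    PreservesInvariants quadraticMaps.{u} (bSeries (rkWeight A b)) := by
  intro Y Z _ _ _ _ _ _ F hF f hf hinv y
  have hFc := polynomialMaps.contDiff hF
  funext N
  refine formalComp_eq_of_isBigO (d := fun n => if n = 0 then F y else 0) hFc ?_
  -- With `N` terms in `κ`, the extra factor `h` makes `S` exactly the stage series truncated at
  -- degree `N`.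
  let κ : Fin s → ℝ → Y := fun i h => ∑ n ∈ Finset.range N, h ^ n • stageSeries A f y i n
  let S : Fin s → ℝ → Y := fun i h => y + ∑ j, A i j • h • κ j h
  have hS : ∀ i h, S i h = ∑ n ∈ Finset.range (N + 1),
      h ^ n • treeSeries f y (fun t => ∑ j, A i j * t.stageWeight A j) n := fun i h =>
    (sum_treeSeries_rk A (A i) f y N h).symm
  have hκ : ∀ i, (fun h => f (S i h) - κ i h) =O[𝓝 0] fun h : ℝ => h ^ N := by
    intro i
    have h1 := comp_treeSeries_isBigO f hf y (fun t => ∑ j, A i j * t.stageWeight A j) N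
    have h2 : (fun h : ℝ => h ^ (N + 1)) =O[𝓝 0] fun h : ℝ => h ^ N := by
      simpa using pow_smul_isBigO (1 : ℝ) N.le_succ
    refine ((h1.trans h2).add (pow_smul_isBigO (stageSeries A f y i N) le_rfl)).congr_left
      fun h => ?_
    simp only [← hS, rootSeries_rk, Finset.sum_range_succ _ N, κ]
    abel
  have hSc : ∀ i, Continuous (S i) := fun i => by fun_prop
  have hF' : Continuous (fderiv ℝ F) := hFc.continuous_fderiv (by simp)
  have hterm : ∀ i, (fun h => b i • h • fderiv ℝ F (S i h) (κ i h - f (S i h))) =O[𝓝 0]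
      fun h : ℝ => h ^ (N + 1) := by
    intro i
    have h1 : (fun h => fderiv ℝ F (S i h)) =O[𝓝 0] fun _ => (1 : ℝ) :=
      ((hF'.comp (hSc i)).tendsto 0).isBigO_one ℝ
    have h2 : (fun h => fderiv ℝ F (S i h) (κ i h - f (S i h))) =O[𝓝 0] fun h : ℝ => h ^ N := by
      have h3 : (fun h => fderiv ℝ F (S i h) (κ i h - f (S i h))) =O[𝓝 0]
          fun h => ‖fderiv ℝ F (S i h)‖ * ‖κ i h - f (S i h)‖ :=
        IsBigO.of_bound 1 (Eventually.of_forall fun h => by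
          rw [one_mul, norm_mul, norm_norm, norm_norm]
          exact (fderiv ℝ F (S i h)).le_opNorm _)
      have h4 := h1.norm_left.mul ((hκ i).neg_left.norm_left)
      simp only [neg_sub, one_mul] at h4
      exact h3.trans h4
    have h5 := ((isBigO_refl (fun h : ℝ => h) (𝓝 0)).smul h2).const_smul_left (b i)
    exact h5.congr_right fun h => by simp [pow_succ']
  refine (IsBigO.fun_sum fun i (_ : i ∈ Finset.univ) => hterm i).congr_left fun h => ?_
  have hb : ∑ i ∈ Finset.range (N + 1), h ^ i • bSeries (rkWeight A b) Y f y i =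
      y + ∑ i, b i • h • κ i h := sum_treeSeries_rk A b f y N h
  rw [hb, quadratic_rk_increment hAb hF, Finset.sum_range_succ']
  have hinv' : ∀ x, fderiv ℝ F x (f x) = 0 := hinv
  simp [S, hinv']

/-! ### Gauss quadrature -/

section Gauss

open Polynomial

theorem exists_polynomial_antiderivative (p : ℝ[X]) :
    ∃ Q : ℝ[X], derivative Q = p ∧ Q.eval 0 = 0 ∧ Q.natDegree ≤ p.natDegree + 1 := by
  refine ⟨∑ i ∈ Finset.range (p.natDegree + 1), C (p.coeff i / (i + 1)) * X ^ (i + 1), ?_, ?_, ?_⟩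
  · conv_rhs => rw [p.as_sum_range_C_mul_X_pow]
    rw [derivative_sum]
    refine Finset.sum_congr rfl fun i _ => ?_
    rw [derivative_C_mul_X_pow, Nat.add_sub_cancel]
    congr 2
    have : (i : ℝ) + 1 ≠ 0 := by positivity
    push_cast
    field_simp
  · simp [eval_finsetSum]
  · refine natDegree_sum_le_of_forall_le _ _ fun i hi => ?_
    rw [Finset.mem_range] at hi
    exact (natDegree_C_mul_X_pow_le _ _).trans (by omega)

theorem integral_eval_derivative (Q : ℝ[X]) (a b : ℝ) :
    ∫ x in a..b, (derivative Q).eval x = Q.eval b - Q.eval a :=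
  intervalIntegral.integral_eq_sub_of_hasDerivAt (fun x _ => Q.hasDerivAt x)
    ((derivative Q).continuous.intervalIntegrable _ _)

theorem integral_eval_add (p q : ℝ[X]) (a b : ℝ) :
    ∫ x in a..b, (p + q).eval x = (∫ x in a..b, p.eval x) + ∫ x in a..b, q.eval x := by
  simp only [eval_add]
  exact intervalIntegral.integral_add (p.continuous.intervalIntegrable _ _)
    (q.continuous.intervalIntegrable _ _)

/-- Integration by parts, one derivative at a time: with fewer than `s` derivatives taken, `X ^ s *
(1 - X) ^ s` is still divisible by `X` and by `1 - X`, so the boundary terms vanish, while `q` loses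
a degree. -/
theorem integral_iterate_derivative_mul_eq_zero (s : ℕ) {k : ℕ} (hk : k ≤ s) {q : ℝ[X]}
    (hq : q.degree < k) :
    ∫ x in (0 : ℝ)..1, (derivative^[k] (X ^ s * (1 - X) ^ s) * q).eval x = 0 := by
  induction k generalizing q with
  | zero =>
    have : q = 0 := by simpa [Nat.WithBot.lt_zero_iff] using hq
    simp [this]
  | succ k ih =>
    by_cases hq0 : q = 0
    · simp [hq0]
    set D := derivative^[k] ((X : ℝ[X]) ^ s * (1 - X) ^ s) with hD
    have h1 : (X : ℝ[X]) ^ (s - k) ∣ D :=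
      pow_sub_dvd_iterate_derivative_of_pow_dvd k (dvd_mul_right _ _)
    have h2 : (1 - X : ℝ[X]) ^ (s - k) ∣ D :=
      pow_sub_dvd_iterate_derivative_of_pow_dvd k (dvd_mul_left _ _)
    have hsk : s - k ≠ 0 := by omega
    have h3 : D.eval 0 = 0 := by
      obtain ⟨r, hr⟩ := h1; rw [hr]; simp [hsk]
    have h4 : D.eval 1 = 0 := by
      obtain ⟨r, hr⟩ := h2; rw [hr]; simp [hsk]
    have h5 : (derivative q).degree < k := by
      have h6 := degree_derivative_lt hq0
      have h7 : q.degree ≤ k := by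
        rw [degree_eq_natDegree hq0] at hq ⊢
        norm_cast at hq ⊢
        omega
      exact h6.trans_le h7
    have h6 := integral_eval_derivative (D * q) 0 1
    rw [derivative_mul, integral_eval_add, ih (by omega) h5] at h6
    rw [Function.iterate_succ_apply']
    simpa [h3, h4] using h6

/-- By Rodrigues' formula, `s!` times the shifted Legendre polynomial is the `s`-th derivative of `X
^ s * (1 - X) ^ s`. -/
theorem integral_shiftedLegendre_mul_eq_zero (s : ℕ) {q : ℝ[X]} (hq : q.degree < s) :
    ∫ x in (0 : ℝ)..1, ((shiftedLegendre s).map (Int.castRingHom ℝ) * q).eval x = 0 := by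
  have h1 := congrArg (Polynomial.map (Int.castRingHom ℝ)) (factorial_mul_shiftedLegendre_eq s)
  simp only [Polynomial.map_mul, ← iterate_derivative_map, Polynomial.map_pow, Polynomial.map_sub,
    map_X, Polynomial.map_one, Polynomial.map_natCast] at h1
  have h2 := integral_iterate_derivative_mul_eq_zero s le_rfl hq
  rw [← h1] at h2
  simp only [mul_assoc, eval_mul, eval_natCast, intervalIntegral.integral_const_mul] at h2 ⊢
  exact (mul_eq_zero.1 h2).resolve_left (by positivity)

theorem integral_eval_of_degree_lt {s : ℕ} {c : Fin s → ℝ} (hc : Function.Injective c) {r : ℝ[X]}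
    (hr : r.degree < s) :
    ∫ x in (0 : ℝ)..1, r.eval x = ∑ i, collocationWeights c i * r.eval (c i) := by
  have h1 := Lagrange.eq_interpolate (s := Finset.univ) (v := c) hc.injOn (f := r) (by simpa using hr)
  conv_lhs => rw [h1, Lagrange.interpolate_apply]
  simp only [eval_finsetSum, eval_mul, eval_C]
  rw [intervalIntegral.integral_finsetSum fun i _ => Continuous.intervalIntegrable (by fun_prop) _ _]
  refine Finset.sum_congr rfl fun i _ => ?_
  rw [intervalIntegral.integral_const_mul, collocationWeights, mul_comm]

/-- Gauss quadrature with `s` nodes is exact for polynomials of degree less than `2 s`. -/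
theorem IsGaussNodes.integral_eval {s : ℕ} {c : Fin s → ℝ} (hc : IsGaussNodes c) {p : ℝ[X]}
    (hp : p.natDegree < 2 * s) :
    ∫ x in (0 : ℝ)..1, p.eval x = ∑ i, collocationWeights c i * p.eval (c i) := by
  set P := (shiftedLegendre s).map (Int.castRingHom ℝ) with hP
  have hPd : P.degree = s := by
    rw [hP, degree_map_eq_of_injective Int.cast_injective, degree_shiftedLegendre]
  have hP0 : P ≠ 0 := by rintro h; simp [h] at hPd
  have hmod : (p % P).degree < s := hPd ▸ degree_mod_lt p hP0
  -- Division by `P` leaves a quotient to which `P` is orthogonal and a remainder on which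
  -- interpolation at the nodes is exact.
  have hdiv : (p / P).degree < s := by
    by_cases h : p.degree < P.degree
    · rw [(Polynomial.div_eq_zero_iff hP0).2 h]; simp
    · have h1 := degree_add_div hP0 (not_lt.1 h)
      by_cases hq : p / P = 0
      · rw [hq]; simp
      have hp0 : p ≠ 0 := by rintro rfl; simp at hq
      rw [degree_eq_natDegree hP0, degree_eq_natDegree hq, degree_eq_natDegree hp0] at h1
      rw [degree_eq_natDegree hP0] at hPd
      rw [degree_eq_natDegree hq]
      norm_cast at *
      omega
  have hroot : ∀ i, P.eval (c i) = 0 := fun i => by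
    have := hc.2 i
    rw [aeval_def, ← eval_map] at this
    exact this
  have hsplit : P * (p / P) + p % P = p := EuclideanDomain.div_add_mod p P
  rw [← hsplit, integral_eval_add, integral_shiftedLegendre_mul_eq_zero s hdiv, zero_add,
    integral_eval_of_degree_lt hc.1 hmod]
  simp [hroot]

/-- Gauss–Legendre collocation methods are symplectic. -/
theorem IsGaussNodes.symplectic {s : ℕ} {c : Fin s → ℝ} (hc : IsGaussNodes c) (i j : Fin s) :
    collocationWeights c i * collocationMatrix c i j +
      collocationWeights c j * collocationMatrix c j i =
        collocationWeights c i * collocationWeights c j := by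
  choose Q hQ hQ0 hQd using fun i => exists_polynomial_antiderivative (Lagrange.basis Finset.univ c i)
  have hA : ∀ i j, collocationMatrix c i j = (Q j).eval (c i) := fun i j => by
    have := integral_eval_derivative (Q j) 0 (c i)
    rwa [hQ0, sub_zero, hQ] at this
  have hb : ∀ j, collocationWeights c j = (Q j).eval 1 := fun j => by
    have := integral_eval_derivative (Q j) 0 1
    rwa [hQ0, sub_zero, hQ] at this
  have hbd : ∀ i, (Lagrange.basis Finset.univ c i).natDegree = s - 1 := fun i => by
    simpa using Lagrange.natDegree_basis hc.1.injOn (Finset.mem_univ i)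
  -- The integrand has degree at most `(s - 1) + s < 2 s`, and among the nodes `ℓᵢ` is nonzero only
  -- at `c i`. Adding the identity with `i` and `j` exchanged gives the integral of `(Qᵢ Qⱼ)'`.
  have key : ∀ i j, collocationWeights c i * collocationMatrix c i j =
      ∫ x in (0 : ℝ)..1, (Lagrange.basis Finset.univ c i * Q j).eval x := fun i j => by
    have hs := i.pos
    have hd : (Lagrange.basis Finset.univ c i * Q j).natDegree < 2 * s := by
      refine natDegree_mul_le.trans_lt ?_
      have := hQd j
      rw [hbd] at this ⊢
      omega
    rw [hc.integral_eval hd, Finset.sum_eq_single i]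
    · rw [eval_mul, Lagrange.eval_basis_self hc.1.injOn (Finset.mem_univ i), one_mul, hA]
    · intro k _ hk
      rw [eval_mul, Lagrange.eval_basis_of_ne hk.symm (Finset.mem_univ k), zero_mul, mul_zero]
    · simp
  rw [key, key, ← integral_eval_add]
  have h := integral_eval_derivative (Q i * Q j) 0 1
  rw [derivative_mul, hQ, hQ, mul_comm (Q i)] at h
  rw [h, hb, hb]
  simp [hQ0]

end Gauss

/-! ### Grafting -/

namespace PlaneTree

/-- Attach `v` as a new subtree at the root. -/
def graft : PlaneTree → PlaneTree → PlaneTree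
  | node k c, v => node (k + 1) (Fin.cons v c)

theorem order_graft (t v : PlaneTree) : (t.graft v).order = t.order + v.order := by
  cases t
  simp only [graft, order, Fin.sum_univ_succ, Fin.cons_zero, Fin.cons_succ]
  omega

theorem Reorder.graft_left {t t' : PlaneTree} (h : Reorder t t') (v : PlaneTree) :
    Reorder (t.graft v) (t'.graft v) := by
  cases h with
  | perm k c e =>
    -- The new subtree sits in position `0`, so `e` is extended by fixing `0`.
    have : (Fin.cons v (c ∘ e) : Fin (k + 1) → PlaneTree) =
        Fin.cons v c ∘ Equiv.Perm.decomposeFin.symm (0, e) := by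
      funext i
      refine Fin.cases ?_ (fun i => ?_) i <;> simp
    simp only [graft]
    rw [this]
    exact Reorder.perm _ _ _
  | sub k c i s h =>
    simp only [graft]
    rw [Fin.cons_update]
    exact Reorder.sub _ _ _ _ (by simpa using h)

theorem Reorder.graft_right (t : PlaneTree) {v v' : PlaneTree} (h : Reorder v v') :
    Reorder (t.graft v) (t.graft v') := by
  cases t with
  | node k c =>
    have := Reorder.sub (k + 1) (Fin.cons v c) 0 v' (by simpa using h)
    rwa [Fin.update_cons_zero] at this

theorem reorder_graft_graft (t v w : PlaneTree) :
    Reorder ((t.graft v).graft w) ((t.graft w).graft v) := by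
  cases t with
  | node k c =>
    have : (Fin.cons v (Fin.cons w c : Fin (k + 1) → PlaneTree) : Fin (k + 2) → PlaneTree) =
        Fin.cons w (Fin.cons v c : Fin (k + 1) → PlaneTree) ∘ Equiv.swap 0 1 := by
      funext i
      refine Fin.cases (by simp) (fun i => Fin.cases ?_ (fun i => ?_) i) i
      · simp
      · rw [Function.comp_apply, Equiv.swap_apply_of_ne_of_ne (Fin.succ_ne_zero _)
          (by rw [← Fin.succ_zero_eq_one]; exact fun h => Fin.succ_ne_zero _ (Fin.succ_injective _ h))]
        simp
    simp only [graft]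
    rw [this]
    exact Reorder.perm _ _ _

theorem Reorder.order_eq {t t' : PlaneTree} (h : Reorder t t') : t.order = t'.order := by
  induction h with
  | perm k c e =>
    simp only [order]
    rw [← Equiv.sum_comp e]; rfl
  | sub k c i t _ ih =>
    simp only [order]
    congr 1
    refine Finset.sum_congr rfl fun m _ => ?_
    by_cases hm : m = i
    · subst hm; simp [ih]
    · simp [Function.update_of_ne hm]

end PlaneTree

namespace ButcherTree

/-- The number of vertices. -/
def order : ButcherTree → ℕ := Quot.lift PlaneTree.order fun _ _ h => h.order_eq

/-- Attach a tree as a new subtree at the root. -/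
def graft : ButcherTree → ButcherTree → ButcherTree :=
  Quot.map₂ PlaneTree.graft (fun t _ _ h => h.graft_right t) fun _ _ v h => h.graft_left v

theorem order_graft (t v : ButcherTree) : (t.graft v).order = t.order + v.order := by
  induction t using Quot.ind
  induction v using Quot.ind
  exact PlaneTree.order_graft _ _

/-- This makes the fold over a multiset in `graftAll` well defined. -/
instance : RightCommutative graft where
  right_comm t v w := by
    induction t using Quot.ind
    induction v using Quot.ind
    induction w using Quot.ind
    exact Quot.sound (reorder_graft_graft _ _ _)

/-- Attach several trees as new subtrees at the root. -/
def graftAll (t : ButcherTree) (M : Multiset ButcherTree) : ButcherTree := M.foldl graft t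

@[simp] theorem graftAll_zero (t : ButcherTree) : t.graftAll 0 = t := rfl

@[simp] theorem graftAll_cons (t v : ButcherTree) (M : Multiset ButcherTree) :
    t.graftAll (v ::ₘ M) = (t.graft v).graftAll M := Multiset.foldl_cons _ _ _ _

theorem graftAll_add (t : ButcherTree) (M M' : Multiset ButcherTree) :
    t.graftAll (M + M') = (t.graftAll M).graftAll M' := Multiset.foldl_add _ _ _ _

theorem graftAll_graft (t v : ButcherTree) (M : Multiset ButcherTree) :
    (t.graft v).graftAll M = (t.graftAll M).graft v := by
  rw [← graftAll_cons, ← Multiset.singleton_add, add_comm, graftAll_add, ← Multiset.cons_zero,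
    graftAll_cons, graftAll_zero]

theorem order_graftAll (t : ButcherTree) (M : Multiset ButcherTree) :
    (t.graftAll M).order = t.order + (M.map order).sum := by
  induction M using Multiset.induction_on generalizing t with
  | empty => simp
  | cons v M ih => rw [graftAll_cons, ih, order_graft, Multiset.map_cons, Multiset.sum_cons, add_assoc]

/-- The tree with one vertex. -/
def leaf : ButcherTree := (node 0 Fin.elim0).toRooted

theorem order_leaf : leaf.order = 1 := rfl

theorem toRooted_node (k : ℕ) (c : Fin k → PlaneTree) :
    (node k c).toRooted = leaf.graftAll (Multiset.ofList (List.ofFn fun i => (c i).toRooted)) := by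
  induction k with
  | zero => exact congrArg (fun c => (node 0 c).toRooted) (Subsingleton.elim _ _)
  | succ k ih =>
    rw [List.ofFn_succ, ← Multiset.cons_coe, graftAll_cons, graftAll_graft, ← ih]
    exact congrArg (fun c => (node (k + 1) c).toRooted) (Fin.cons_self_tail c).symm

theorem exists_eq_graftAll (t : ButcherTree) : ∃ M, t = leaf.graftAll M := by
  induction t using Quot.ind with
  | mk t =>
    cases t with
    | node k c => exact ⟨_, toRooted_node k c⟩

/-! ### Functional equations for the coefficients -/

section Characters

open Classical

/-- The conditions for products of two and three coordinates imply those for all products. -/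
theorem prod_eq_sum_graftAll {a : ButcherTree → ℝ}
    (h₂ : ∀ u v, a u * a v = a (u.graft v) + a (v.graft u))
    (h₃ : ∀ u v w, a u * a v * a w =
      a ((u.graft v).graft w) + a ((v.graft u).graft w) + a ((w.graft u).graft v))
    (n : ℕ) {M : Multiset ButcherTree} (hM : M.card = n + 1) :
    (M.map a).prod = (M.map fun s => a (s.graftAll (M.erase s))).sum := by
  induction n generalizing M with
  | zero =>
    obtain ⟨s, rfl⟩ := Multiset.card_eq_one.1 hM
    simp
  | succ n ih =>
    obtain ⟨s₁, hs⟩ := (Multiset.card_pos_iff_exists_mem (s := M)).1 (by omega)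
    obtain ⟨M₁, rfl⟩ := Multiset.exists_cons_of_mem hs
    clear hs
    rw [Multiset.card_cons, Nat.add_right_cancel_iff] at hM
    obtain ⟨s₂, hs⟩ := (Multiset.card_pos_iff_exists_mem (s := M₁)).1 (by omega)
    obtain ⟨M, rfl⟩ := Multiset.exists_cons_of_mem hs
    clear hs
    rw [Multiset.card_cons, Nat.add_right_cancel_iff] at hM
    -- Merge `s₁` and `s₂` in both possible ways. Each multiset has one element less, and by `h₂`
    -- the two left-hand sides add up to the full product.
    have e₁ := ih (M := s₁.graft s₂ ::ₘ M) (by simp [hM])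
    have e₂ := ih (M := s₂.graft s₁ ::ₘ M) (by simp [hM])
    have hsum : ∀ x : ButcherTree, (((x ::ₘ M).map fun s => a (s.graftAll ((x ::ₘ M).erase s))).sum) =
        a (x.graftAll M) + (M.map fun s => a ((s.graftAll (M.erase s)).graft x)).sum := by
      intro x
      rw [Multiset.map_cons, Multiset.sum_cons, Multiset.erase_cons_head]
      congr 2
      refine Multiset.map_congr rfl fun s hs => ?_
      rw [Multiset.erase_cons_tail_of_mem hs, graftAll_cons, graftAll_graft]
    rw [hsum] at e₁ e₂
    -- Expanding `a X * a s₁ * a s₂` once by `h₃`, and once by `h₂` applied twice, leaves this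
    -- relation.
    have hx : ∀ X : ButcherTree, a (X.graft (s₁.graft s₂)) + a (X.graft (s₂.graft s₁)) =
        a ((X.graft s₁).graft s₂) := by
      intro X
      have c₁ : (s₁.graft X).graft s₂ = (s₁.graft s₂).graft X := RightCommutative.right_comm _ _ _
      have c₂ : (s₂.graft X).graft s₁ = (s₂.graft s₁).graft X := RightCommutative.right_comm _ _ _
      have e₃ := h₃ X s₁ s₂
      rw [c₁, c₂] at e₃
      linear_combination e₃ - h₂ X (s₁.graft s₂) - h₂ X (s₂.graft s₁) - a X * h₂ s₁ s₂
    have hM' : (M.map fun s => a (s.graftAll ((s₁ ::ₘ s₂ ::ₘ M).erase s))) =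
        M.map fun s => a ((s.graftAll (M.erase s)).graft (s₁.graft s₂)) +
          a ((s.graftAll (M.erase s)).graft (s₂.graft s₁)) := by
      refine Multiset.map_congr rfl fun s hs => ?_
      rw [Multiset.erase_cons_tail_of_mem (Multiset.mem_cons_of_mem hs),
        Multiset.erase_cons_tail_of_mem hs, graftAll_cons, graftAll_cons, graftAll_graft,
        graftAll_graft, hx]
    have hs₂ : (s₁ ::ₘ s₂ ::ₘ M).erase s₂ = s₁ ::ₘ M := by
      rw [Multiset.cons_swap, Multiset.erase_cons_head]
    rw [Multiset.map_cons, Multiset.map_cons, Multiset.map_cons, Multiset.map_cons,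
      Multiset.sum_cons, Multiset.sum_cons, hM',
      Multiset.sum_map_add, Multiset.erase_cons_head, hs₂, graftAll_cons, graftAll_cons,
      Multiset.prod_cons, Multiset.prod_cons]
    rw [Multiset.map_cons, Multiset.prod_cons] at e₁ e₂
    linear_combination e₁ + e₂ + (M.map a).prod * h₂ s₁ s₂

/-- The product equation for `leaf ::ₘ M` sums `a` over the tree `t = leaf.graftAll M` and the trees
obtained by moving its root to a child `s`. All have `n` vertices. If `s` is a leaf, the result is
`t` again; otherwise the new root has more children than the old one. Hence the induction on the
order `n` and, inside it, on `m`, which is `n` minus the number of root subtrees. -/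
theorem order_mul_eq {a : ButcherTree → ℝ}
    (h₂ : ∀ u v, a u * a v = a (u.graft v) + a (v.graft u))
    (h₃ : ∀ u v w, a u * a v * a w =
      a ((u.graft v).graft w) + a ((v.graft u).graft w) + a ((w.graft u).graft v))
    (n m : ℕ) {M : Multiset ButcherTree} (hn : (leaf.graftAll M).order = n)
    (hm : n = M.card + m) :
    (n : ℝ) * a (leaf.graftAll M) = a leaf * (M.map a).prod := by
  induction n using Nat.strong_induction_on generalizing m M with
  | _ n ihn =>
    induction m using Nat.strong_induction_on generalizing M with
    | _ m ihm =>
      set x := (n : ℝ) * a (leaf.graftAll M)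
      set Q := a leaf * (M.map a).prod with hQ
      have hord : n = 1 + (M.map order).sum := by rw [← hn, order_graftAll, order_leaf]
      have h1 := prod_eq_sum_graftAll h₂ h₃ M.card (M := leaf ::ₘ M) (by simp)
      rw [Multiset.map_cons, Multiset.map_cons, Multiset.prod_cons, Multiset.sum_cons,
        Multiset.erase_cons_head] at h1
      -- For `s ≠ leaf` the inner induction evaluates the re-rooted tree and the outer one evaluates
      -- `s`, giving `|s| Q`. For `s = leaf` the term is the unknown `x` itself, written as `Q + (x
      -- - Q)`.
      have h2 : ∀ s ∈ M, (n : ℝ) * a (s.graftAll ((leaf ::ₘ M).erase s)) =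
          s.order * Q + (if s = leaf then 1 else 0) * (x - Q) := by
        intro s hs
        rw [Multiset.erase_cons_tail_of_mem hs]
        split_ifs with hsl
        · subst hsl
          have : leaf.graftAll (leaf ::ₘ M.erase leaf) = leaf.graftAll M := by
            rw [Multiset.cons_erase hs]
          rw [this, order_leaf]
          simp only [x]; push_cast; ring
        · obtain ⟨Ms, hMs⟩ := exists_eq_graftAll s
          have hMs0 : 0 < Ms.card := by
            rw [Multiset.card_pos]
            rintro rfl
            exact hsl hMs
          have hsM : s.order ≤ (M.map order).sum :=
            Multiset.single_le_sum (fun _ _ => Nat.zero_le _) _ (Multiset.mem_map_of_mem _ hs)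
          have hle : ∀ M : Multiset ButcherTree, M.card ≤ (M.map order).sum := by
            intro M
            induction M using Multiset.induction_on with
            | empty => simp
            | cons v M ih =>
              have : 0 < v.order := by
                induction v using Quot.ind
                exact PlaneTree.order_pos _
              rw [Multiset.card_cons, Multiset.map_cons, Multiset.sum_cons]; omega
          have e : s.graftAll (leaf ::ₘ M.erase s) =
              leaf.graftAll (Ms + leaf ::ₘ M.erase s) := by
            rw [graftAll_add, ← hMs]
          have hMe := congrArg (fun M : Multiset ButcherTree => (M.map order).sum)
            (Multiset.cons_erase hs)
          have hMc := Multiset.card_erase_add_one hs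
          have hso : s.order = 1 + (Ms.map order).sum := by
            conv_lhs => rw [hMs, order_graftAll, order_leaf]
          simp only [Multiset.map_cons, Multiset.sum_cons] at hMe
          have hc : (Ms + leaf ::ₘ M.erase s).card = Ms.card + M.card := by
            simp only [Multiset.card_add, Multiset.card_cons]; omega
          have ho : (leaf.graftAll (Ms + leaf ::ₘ M.erase s)).order = n := by
            rw [order_graftAll, order_leaf, Multiset.map_add, Multiset.sum_add, Multiset.map_cons,
              Multiset.sum_cons, order_leaf]
            omega
          have hle' := hle (Ms + leaf ::ₘ M.erase s)
          rw [order_graftAll, order_leaf] at ho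
          have i1 := ihm (m - Ms.card) (by omega) (M := Ms + leaf ::ₘ M.erase s)
            (by rw [order_graftAll, order_leaf]; exact ho) (by omega)
          have hle'' := hle Ms
          have i2 := ihn s.order (by omega) (s.order - Ms.card) (M := Ms) (by rw [← hMs]) (by omega)
          rw [← hMs] at i2
          rw [e, i1, Multiset.map_add, Multiset.prod_add, Multiset.map_cons, Multiset.prod_cons,
            hQ, ← Multiset.prod_map_erase hs]
          linear_combination (-(a leaf * ((M.erase s).map a).prod)) * i2
      have h3 : (n : ℝ) * Q = x + ((M.map order).sum * Q +
          (M.map fun s => if s = leaf then (1 : ℝ) else 0).sum * (x - Q)) := by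
        have h6 : (n : ℝ) * Q = x + (M.map fun s =>
            (n : ℝ) * a (s.graftAll ((leaf ::ₘ M).erase s))).sum := by
          rw [Multiset.sum_map_mul_left, ← mul_add, ← h1]
        rw [h6, Multiset.map_congr rfl h2, Multiset.sum_map_add, Multiset.sum_map_mul_right,
          Multiset.sum_map_mul_right, Nat.cast_multiset_sum, Multiset.map_map]
        rfl
      have h4 : 0 ≤ (M.map fun s => if s = leaf then (1 : ℝ) else 0).sum := by
        refine Multiset.sum_nonneg fun r hr => ?_
        obtain ⟨s, _, rfl⟩ := Multiset.mem_map.1 hr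
        split_ifs <;> norm_num
      -- Since `n = 1 + ∑ |s|`, the multiples of `Q` cancel. What remains is `x - Q` times one plus
      -- the number of leaf children, a positive factor.
      have h5 : (1 + (M.map fun s => if s = leaf then (1 : ℝ) else 0).sum) * (x - Q) = 0 := by
        have : (n : ℝ) = 1 + ((M.map order).sum : ℕ) := by exact_mod_cast hord
        rw [this] at h3
        linear_combination -h3
      have := (mul_eq_zero.1 h5).resolve_left (by positivity)
      linarith

end Characters

end ButcherTree

/-! ### A vector field that separates trees -/

/-- Euclidean space with one coordinate for each plane tree with at most `N` vertices. -/
abbrev TreeSpace (N : ℕ) : Type u := ULift.{u} {t : PlaneTree // t ∈ ofOrderLE N} → ℝ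

open Classical in
/-- The coordinate of a tree; it vanishes for trees with more than `N` vertices. -/
def treeCoord (N : ℕ) (t : PlaneTree) : TreeSpace.{u} N →L[ℝ] ℝ :=
  if h : t ∈ ofOrderLE N then ContinuousLinearMap.proj ⟨⟨t, h⟩⟩ else 0

/-- The product of the coordinates of the subtrees at the root. -/
def treeMonomial (N : ℕ) : PlaneTree → TreeSpace.{u} N → ℝ
  | node _ c, y => ∏ i, treeCoord N (c i) y

/-- The vector field whose components are the tree monomials. -/
def treeField (N : ℕ) (y : TreeSpace.{u} N) : TreeSpace.{u} N := fun i => treeMonomial N i.down.1 y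

theorem contDiff_treeMonomial (N : ℕ) (t : PlaneTree) : ContDiff ℝ ∞ (treeMonomial.{u} N t) := by
  cases t with
  | node k c => exact contDiff_prod fun i _ => (treeCoord N (c i)).contDiff

theorem contDiff_treeField (N : ℕ) : ContDiff ℝ ∞ (treeField.{u} N) :=
  contDiff_pi.2 fun i => contDiff_treeMonomial N i.down.1

theorem treeCoord_treeField {N : ℕ} {t : PlaneTree} (ht : t.order ≤ N) (y : TreeSpace.{u} N) :
    treeCoord N t (treeField N y) = treeMonomial N t y := by
  rw [treeCoord, dif_pos (mem_ofOrderLE.2 ht)]; rfl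

theorem treeMonomial_graft (N : ℕ) (t v : PlaneTree) (y : TreeSpace.{u} N) :
    treeMonomial N (t.graft v) y = treeCoord N v y * treeMonomial N t y := by
  cases t with
  | node k c => simp [PlaneTree.graft, treeMonomial, Fin.prod_univ_succ]

theorem treeCoord_elementaryDifferential {N : ℕ} {t : PlaneTree} (ht : t.order ≤ N)
    (y : TreeSpace.{u} N) (t' : PlaneTree) :
    treeCoord N t (t'.elementaryDifferential (treeField N) y) =
      rootDifferential (treeField N) (treeMonomial N t) y t' := by
  rw [elementaryDifferential_eq, ← rootDifferential_clm_comp (contDiff_treeField N)]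
  congr 1
  exact funext (treeCoord_treeField ht)

theorem iteratedFDeriv_prod_clm_zero {k : ℕ} (l : Fin k → Y →L[ℝ] ℝ) (v : Fin k → Y) :
    iteratedFDeriv ℝ k (fun y => ∏ i, l i y) 0 v = ∑ σ : Equiv.Perm (Fin k), ∏ i, l i (v (σ i)) :=
  ((ContinuousMultilinearMap.mkPiAlgebra ℝ (Fin k) ℝ).compContinuousLinearMap
    l).iteratedFDeriv_comp_diagonal 0 v

/-- By homogeneity: substituting `2 y` multiplies the function by `2 ^ k` and its `m`-th derivative
at `0` by `2 ^ m`. -/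
theorem iteratedFDeriv_prod_clm_zero_of_ne {k m : ℕ} (h : m ≠ k) (l : Fin k → Y →L[ℝ] ℝ)
    (v : Fin m → Y) : iteratedFDeriv ℝ m (fun y => ∏ i, l i y) 0 v = 0 := by
  set G : Y → ℝ := fun y => ∏ i, l i y with hG
  have hGc : ContDiff ℝ m G := contDiff_prod fun i _ => (l i).contDiff
  have h1 := ((2 : ℝ) • ContinuousLinearMap.id ℝ Y).iteratedFDeriv_comp_right hGc 0 (i := m) le_rfl
  have h2 : G ∘ ((2 : ℝ) • ContinuousLinearMap.id ℝ Y) = (2 : ℝ) ^ k • G := by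
    funext y; simp [hG, Finset.prod_mul_distrib]
  rw [h2, iteratedFDeriv_const_smul_apply hGc.contDiffAt] at h1
  have h3 := congrArg (fun M => M v) h1
  have h4 : (fun i => (2 : ℝ) • v i) = fun i => (fun _ => (2 : ℝ)) i • v i := rfl
  simp only [smul_apply, map_zero, ContinuousMultilinearMap.compContinuousLinearMap_apply,
    ContinuousLinearMap.id_apply] at h3
  rw [h4, ContinuousMultilinearMap.map_smul_univ] at h3
  simp only [Finset.prod_const, Finset.card_univ, Fintype.card_fin, smul_eq_mul] at h3
  have h5 : ((2 : ℝ) ^ k - 2 ^ m) * iteratedFDeriv ℝ m G 0 v = 0 := by linear_combination h3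
  refine (mul_eq_zero.1 h5).resolve_left fun h6 => h ?_
  exact (pow_right_injective₀ (by norm_num : (0 : ℝ) < 2) (by norm_num) (sub_eq_zero.1 h6)).symm

/-- At `0` only the derivative of order `k` of a product of `k` coordinates survives. It is a sum
over permutations, and a nonzero term matches the subtrees of `t` with those of `T`, recursively. -/
theorem toRooted_eq_of_rootDifferential_ne_zero {N : ℕ} {T : PlaneTree} (hT : T.order ≤ N)
    {t : PlaneTree} (h : rootDifferential (treeField.{u} N) (treeMonomial N T) 0 t ≠ 0) :
    t.toRooted = T.toRooted := by
  induction T generalizing t with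
  | node k c ih =>
    cases t with
    | node m c' =>
      change iteratedFDeriv ℝ m (fun y => ∏ i, treeCoord N (c i) y) 0 _ ≠ 0 at h
      by_cases hmk : m = k
      · subst hmk
        rw [iteratedFDeriv_prod_clm_zero] at h
        obtain ⟨σ, _, hσ⟩ := Finset.exists_ne_zero_of_sum_ne_zero h
        rw [Finset.prod_ne_zero_iff] at hσ
        have h1 : ∀ i, (c' (σ i)).toRooted = (c i).toRooted := fun i => by
          have hi : (c i).order ≤ N := (order_child_lt c i).le.trans hT
          refine ih i hi ?_
          rw [← treeCoord_elementaryDifferential hi]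
          exact hσ i (Finset.mem_univ i)
        have h2 : (node m c').toRooted = (node m (c' ∘ σ)).toRooted :=
          Quot.sound (Reorder.perm _ _ _)
        rw [h2, ButcherTree.toRooted_node, ButcherTree.toRooted_node]
        simp only [Function.comp_apply, h1]
      · exact absurd (iteratedFDeriv_prod_clm_zero_of_ne hmk _ _) h

/-! ### Coordinates of B-series along the separating field -/

theorem sum_pow_smul_ite (n N : ℕ) (h r : ℝ) :
    ∑ m ∈ Finset.range N, h ^ m • (if m = n then r else 0) = if n < N then h ^ n * r else 0 := by
  simp only [smul_eq_mul, mul_ite, mul_zero, Finset.sum_ite_eq', Finset.mem_range]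

theorem prod_treeCoord_isBigO {N : ℕ} {w : PlaneTree → ℝ} {k : ℕ} {c : Fin k → PlaneTree}
    {r : Fin k → ℝ}
    (h : ∀ i n, treeCoord N (c i) (treeSeries (treeField.{u} N) 0 w n) =
      if n = (c i).order then r i else 0) (n : ℕ) :
    (fun x : ℝ => (∏ i, treeCoord N (c i)
      (∑ m ∈ Finset.range (n + 1), x ^ m • treeSeries (treeField.{u} N) 0 w m)) -
        ∑ m ∈ Finset.range (n + 1), x ^ m • (if m = ∑ i, (c i).order then ∏ i, r i else 0))
          =O[𝓝 0] fun x : ℝ => x ^ (n + 1) := by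
  have h1 : ∀ x : ℝ, (∏ i, treeCoord N (c i)
      (∑ m ∈ Finset.range (n + 1), x ^ m • treeSeries (treeField.{u} N) 0 w m)) =
        ∏ i, if (c i).order < n + 1 then x ^ (c i).order * r i else 0 := by
    intro x
    refine Finset.prod_congr rfl fun i _ => ?_
    simp only [map_sum, map_smul, h, sum_pow_smul_ite]
  simp only [h1, sum_pow_smul_ite]
  -- If no factor is truncated away, the product is a single monomial; otherwise it is zero, and the
  -- total order exceeds `n` as well.
  by_cases h2 : ∀ i, (c i).order < n + 1
  · have h3 : ∀ x : ℝ, (∏ i, if (c i).order < n + 1 then x ^ (c i).order * r i else 0) =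
        x ^ (∑ i, (c i).order) • ∏ i, r i := by
      intro x
      simp only [h2, if_true, Finset.prod_mul_distrib, Finset.prod_pow_eq_pow_sum, smul_eq_mul]
    simp only [h3]
    split_ifs with h4
    · simpa using isBigO_zero _ _
    · simpa using pow_smul_isBigO (∏ i, r i) (not_lt.1 h4)
  · push Not at h2
    obtain ⟨i, hi⟩ := h2
    have h3 : (c i).order ≤ ∑ i, (c i).order :=
      Finset.single_le_sum (f := fun i => (c i).order) (fun _ _ => Nat.zero_le _)
        (Finset.mem_univ i)
    have h4 : ∀ x : ℝ, (∏ i, if (c i).order < n + 1 then x ^ (c i).order * r i else 0) = 0 :=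
      fun x => Finset.prod_eq_zero (Finset.mem_univ i) (if_neg (by omega))
    simp only [h4, if_neg (show ¬ ∑ i, (c i).order < n + 1 by omega), sub_zero]
    exact isBigO_zero _ _

theorem treeCoord_treeSeries {N : ℕ} {t : PlaneTree} (ht : t.order ≤ N) (w : PlaneTree → ℝ)
    {n : ℕ} (hn : n ≠ 0) :
    treeCoord N t (treeSeries (treeField.{u} N) 0 w n) =
      ∑ t' ∈ ofOrder n, (w t' / t'.branchFactorial) *
        rootDifferential (treeField.{u} N) (treeMonomial N t) 0 t' := by
  rw [treeSeries, if_neg hn, map_sum]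
  refine Finset.sum_congr rfl fun t' _ => ?_
  rw [map_smul, smul_eq_mul, treeCoord_elementaryDifferential ht]

/-- For the weights identically `1`, the composition formula and induction on `T` show that the
coordinate at `T` is `h ^ |T|`. The normalization is thus found without computing a symmetry factor.
-/
theorem sum_rootDifferential_treeMonomial {N : ℕ} {T : PlaneTree} (hT : T.order ≤ N) {n : ℕ}
    (hn : n ≠ 0) :
    ∑ t ∈ ofOrder n, (1 / t.branchFactorial : ℝ) *
      rootDifferential (treeField.{u} N) (treeMonomial N T) 0 t = if n = T.order then 1 else 0 := by
  induction T generalizing n with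
  | node k c ih =>
    have h1 : ∀ i n, treeCoord N (c i) (treeSeries (treeField.{u} N) 0 (fun _ => 1) n) =
        if n = (c i).order then 1 else 0 := by
      intro i n
      have hi : (c i).order ≤ N := (order_child_lt c i).le.trans hT
      by_cases hn : n = 0
      · have := (c i).order_pos
        rw [hn, treeSeries_zero, map_zero, if_neg (by omega)]
      · rw [treeCoord_treeSeries hi _ hn, ih i hi hn]
    obtain ⟨m, rfl⟩ := Nat.exists_eq_succ_of_ne_zero hn
    have h2 := prod_treeCoord_isBigO h1 m
    have h3 := coeff_eq_of_isBigO (comp_treeSeries_isBigO (treeField.{u} N)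
      (contDiff_treeMonomial N (node k c)) 0 (fun _ => 1) m) h2
    have h4 : ∀ t, childWeight (fun _ => 1) t = 1 := fun t => by cases t; simp [childWeight]
    simp only [rootSeries, h4, smul_eq_mul] at h3
    rw [h3]
    simp only [Finset.prod_const_one, order]
    congr 1
    exact propext ⟨fun h => by omega, fun h => by omega⟩

/-- Only the plane representatives of the rooted tree of `T` contribute, and `a` is constant on
them, so it factors out of the sum with weights `1`. -/
theorem sum_mul_rootDifferential_treeMonomial (a : ButcherTree → ℝ) {N : ℕ} {T : PlaneTree}
    (hT : T.order ≤ N) {n : ℕ} (hn : n ≠ 0) :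
    ∑ t ∈ ofOrder n, (a t.toRooted / t.branchFactorial) *
      rootDifferential (treeField.{u} N) (treeMonomial N T) 0 t =
        if n = T.order then a T.toRooted else 0 := by
  have h1 := congrArg (a T.toRooted * ·) (sum_rootDifferential_treeMonomial.{u} hT hn)
  simp only [mul_ite, mul_one, mul_zero, Finset.mul_sum] at h1
  rw [← h1]
  refine Finset.sum_congr rfl fun t _ => ?_
  by_cases h : rootDifferential (treeField.{u} N) (treeMonomial N T) 0 t = 0
  · rw [h]; ring
  · rw [toRooted_eq_of_rootDifferential_ne_zero hT h]; ring

theorem treeCoord_bSeries (a : ButcherTree → ℝ) {N : ℕ} {t : PlaneTree} (ht : t.order ≤ N)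
    (n : ℕ) : treeCoord N t (treeSeries (treeField.{u} N) 0 (fun t => a t.toRooted) n) =
      if n = t.order then a t.toRooted else 0 := by
  by_cases hn : n = 0
  · have := t.order_pos
    rw [hn, treeSeries_zero, map_zero, if_neg (by omega)]
  · rw [treeCoord_treeSeries ht _ hn, sum_mul_rootDifferential_treeMonomial a ht hn]

/-! ### Cubic equivariance forces the exact flow -/

theorem rootDifferential_sum {ι : Type*} (s : Finset ι) {f : Y → Y} {Z : Type*}
    [NormedAddCommGroup Z] [NormedSpace ℝ Z] {G : ι → Y → Z} (hG : ∀ i, ContDiff ℝ ∞ (G i))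
    (y : Y) (t : PlaneTree) :
    rootDifferential f (fun x => ∑ i ∈ s, G i x) y t = ∑ i ∈ s, rootDifferential f (G i) y t := by
  cases t with
  | node k c =>
    have h := iteratedFDeriv_sum (𝕜 := ℝ) (i := k) (f := G) (u := s)
      (fun i _ => (hG i).of_le (by exact_mod_cast le_top))
    simp only [rootDifferential]
    rw [h]
    simp

/-- The target `PUnit → ℝ` is a copy of the real line in universe `u`. -/
theorem cubicMaps_prod_clm {k : ℕ} (hk : k ≤ 3) (l : Fin k → Y →L[ℝ] ℝ) :
    cubicMaps Y (PUnit.{u + 1} → ℝ) fun y _ => ∏ i, l i y := by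
  let p : (k : ℕ) → ContinuousMultilinearMap ℝ (fun _ : Fin k => Y) (PUnit.{u + 1} → ℝ) :=
    Function.update 0 k (ContinuousMultilinearMap.pi fun _ =>
      (ContinuousMultilinearMap.mkPiAlgebra ℝ (Fin k) ℝ).compContinuousLinearMap l)
  refine ⟨p, fun y => ?_⟩
  rw [Finset.sum_eq_single k]
  · funext i; simp [p]
  · intro m _ hm; simp [p, hm]
  · intro h; simp at h; omega

/-- Compare the coefficients of `h ^ n` at `0` for the product of the coordinates `u i`. The left
side is the product of their leading coefficients; on the right, `F' f` is a sum of tree monomials,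
each of which picks out one value of `a`. -/
theorem sum_eq_of_cubic_equivariant {a : ButcherTree → ℝ}
    (ha : FunctionallyEquivariant cubicMaps.{u} (bSeries a)) {N n : ℕ} (hn : n ≠ 0) (hnN : n ≤ N)
    {k m : ℕ} (hk : k ≤ 3) (u : Fin k → PlaneTree) (hu : ∑ i, (u i).order = n)
    (T : Fin m → PlaneTree) (hT : ∀ i, (T i).order = n)
    (h : ∀ y, fderiv ℝ (fun y : TreeSpace.{u} N => ∏ i, treeCoord N (u i) y) y (treeField N y) =
      ∑ i, treeMonomial N (T i) y) :
    ∏ i, a (u i).toRooted = ∑ i, a (T i).toRooted := by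
  set G : TreeSpace.{u} N → ℝ := fun y => ∏ i, treeCoord N (u i) y with hG
  have hGc : ContDiff ℝ ∞ G := contDiff_prod fun i _ => (treeCoord N (u i)).contDiff
  have hFq := cubicMaps_prod_clm hk fun i => treeCoord.{u} N (u i)
  have hFc := polynomialMaps.contDiff hFq
  have huN : ∀ i, (u i).order ≤ N := fun i =>
    ((Finset.single_le_sum (f := fun i => (u i).order) (fun _ _ => Nat.zero_le _)
      (Finset.mem_univ i)).trans hu.le).trans hnN
  have h1 := congrFun (ha _ _ _ hFq (treeField N) (contDiff_treeField N) 0) n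
  rw [formalComp_graph hFc, bSeries_eq_treeSeries, bSeries_eq_treeSeries] at h1
  have h2 := congrArg Prod.snd h1
  rw [snd_treeSeries_augmentedField hFc (contDiff_treeField N) _ _ hn] at h2
  have h3 := prod_treeCoord_isBigO (fun i => treeCoord_bSeries a (huN i)) n
  have h4 := formalComp_eq_of_isBigO (d := fun m (_ : PUnit.{u + 1}) =>
    if m = ∑ i, (u i).order then ∏ i, a (u i).toRooted else 0) hFc (c :=
      treeSeries (treeField.{u} N) 0 fun t => a t.toRooted) (n := n) (by
      rw [isBigO_pi]
      intro i
      simpa using h3)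
  rw [h4] at h2
  have h5 := congrFun h2 PUnit.unit
  simp only [hu, if_true, Finset.sum_apply, Pi.smul_apply] at h5
  rw [h5]
  have h6 : ∀ t, rootDifferential (treeField.{u} N) (fun x => fderiv ℝ
      (fun y (_ : PUnit.{u + 1}) => ∏ i, treeCoord N (u i) y) x (treeField N x)) 0 t PUnit.unit =
        ∑ i, rootDifferential (treeField.{u} N) (treeMonomial N (T i)) 0 t := by
    intro t
    have h7 := rootDifferential_clm_comp (f := treeField.{u} N)
      (contDiff_fderiv_apply hFc (contDiff_treeField N))
      (ContinuousLinearMap.proj PUnit.unit : (PUnit.{u + 1} → ℝ) →L[ℝ] ℝ) 0 t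
    refine h7.symm.trans ?_
    rw [← rootDifferential_sum _ fun i => contDiff_treeMonomial N (T i)]
    congr 1
    funext x
    rw [← h x]
    have h8 : HasFDerivAt (fun y (_ : PUnit.{u + 1}) => ∏ i, treeCoord N (u i) y)
        (ContinuousLinearMap.pi fun _ => fderiv ℝ G x) x :=
      hasFDerivAt_pi.2 fun _ => (hGc.differentiable (by simp) x).hasFDerivAt
    rw [h8.fderiv]
    rfl
  simp only [h6, smul_eq_mul, Finset.mul_sum]
  rw [Finset.sum_comm]
  refine Finset.sum_congr rfl fun i _ => ?_
  rw [sum_mul_rootDifferential_treeMonomial a ((hT i).le.trans hnN) hn, if_pos (hT i).symm]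

/-- Along the field the coordinate of `u` has derivative `treeMonomial N u`, and multiplying this by
the coordinate of `v` gives the monomial of `u.graft v`. The equation is therefore the product rule.
-/
theorem mul_eq_of_cubic_equivariant {a : ButcherTree → ℝ}
    (ha : FunctionallyEquivariant cubicMaps.{u} (bSeries a)) (u v : ButcherTree) :
    a u * a v = a (u.graft v) + a (v.graft u) := by
  induction u using Quot.ind with
  | mk u =>
  induction v using Quot.ind with
  | mk v =>
  have hu := u.order_pos
  have h := sum_eq_of_cubic_equivariant ha (n := u.order + v.order) (by omega) le_rfl
    (by norm_num) ![u, v] (by simp [Fin.sum_univ_succ]) ![u.graft v, v.graft u]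
    (by
      intro i
      fin_cases i
      · exact PlaneTree.order_graft u v
      · exact (PlaneTree.order_graft v u).trans (add_comm _ _))
    (by
      intro y
      have hd := (treeCoord _ u).hasFDerivAt (x := y) |>.mul ((treeCoord _ v).hasFDerivAt (x := y))
      simp only [Fin.prod_univ_two, Fin.sum_univ_two, Matrix.cons_val_zero, Matrix.cons_val_one]
      refine (congrArg (· (treeField _ y)) hd.fderiv).trans ?_
      simp only [treeMonomial_graft, add_apply, smul_apply, smul_eq_mul]
      rw [treeCoord_treeField (by omega), treeCoord_treeField (by omega)]
      ring)
  simp only [Fin.prod_univ_two, Fin.sum_univ_two, Matrix.cons_val_zero, Matrix.cons_val_one] at h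
  exact h

theorem mul_mul_eq_of_cubic_equivariant {a : ButcherTree → ℝ}
    (ha : FunctionallyEquivariant cubicMaps.{u} (bSeries a)) (u v w : ButcherTree) :
    a u * a v * a w =
      a ((u.graft v).graft w) + a ((v.graft u).graft w) + a ((w.graft u).graft v) := by
  induction u using Quot.ind with
  | mk u =>
  induction v using Quot.ind with
  | mk v =>
  induction w using Quot.ind with
  | mk w =>
  have hu := u.order_pos
  have h := sum_eq_of_cubic_equivariant ha (n := u.order + v.order + w.order) (by omega) le_rfl
    le_rfl ![u, v, w] (by simp [Fin.sum_univ_succ]; ring)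
    ![(u.graft v).graft w, (v.graft u).graft w, (w.graft u).graft v]
    (by
      intro i
      fin_cases i <;> simp [PlaneTree.order_graft] <;> ring)
    (by
      intro y
      have hd := ((treeCoord _ u).hasFDerivAt (x := y) |>.mul
        ((treeCoord _ v).hasFDerivAt (x := y))).mul ((treeCoord _ w).hasFDerivAt (x := y))
      simp only [Fin.prod_univ_three, Fin.sum_univ_three, Matrix.cons_val]
      refine (congrArg (· (treeField _ y)) hd.fderiv).trans ?_
      simp only [treeMonomial_graft, add_apply, smul_apply, smul_eq_mul, Pi.mul_apply]
      rw [treeCoord_treeField (by omega), treeCoord_treeField (by omega),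
        treeCoord_treeField (by omega)]
      ring)
  simp only [Fin.prod_univ_three, Fin.sum_univ_three, Matrix.cons_val] at h
  exact h

/-- The recursion `key` is the equation `dY/dh = r f(Y)` compared tree by tree, with `f(Y)` expanded
by the composition formula. -/
theorem isExactFlow_of_cubic_equivariant {a : ButcherTree → ℝ}
    (ha : FunctionallyEquivariant cubicMaps.{u} (bSeries a)) :
    IsExactFlow.{u} (a ButcherTree.leaf) (bSeries a) := by
  have key : ∀ t : PlaneTree, (t.order : ℝ) * a t.toRooted =
      a ButcherTree.leaf * childWeight (fun t => a t.toRooted) t := by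
    rintro ⟨k, c⟩
    have hord : (ButcherTree.order (node k c).toRooted) = (node k c).order := rfl
    have hlt := card_children_lt c
    have h := ButcherTree.order_mul_eq (mul_eq_of_cubic_equivariant ha)
      (mul_mul_eq_of_cubic_equivariant ha) (node k c).order ((node k c).order - k)
      (M := Multiset.ofList (List.ofFn fun i => (c i).toRooted))
      (by rw [← ButcherTree.toRooted_node, hord]) (by simp; omega)
    rw [← ButcherTree.toRooted_node] at h
    rw [h, childWeight]
    simp [List.prod_ofFn]
  intro Y _ _ _ f hf y
  refine ⟨rfl, fun n => ?_⟩
  rw [bSeries_eq_treeSeries, formalComp_treeSeries f hf, treeSeries, if_neg n.succ_ne_zero,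
    rootSeries, Finset.smul_sum, Finset.smul_sum]
  refine Finset.sum_congr rfl fun t ht => ?_
  have hk := key t
  rw [mem_ofOrder.1 ht] at hk
  rw [elementaryDifferential_eq, smul_smul, smul_smul, ← mul_div_assoc, ← mul_div_assoc, ← hk]
  push_cast
  rfl

end

theorem mainTheorem3 :
    -- (a)
    (∀ a : ButcherTree → ℝ, FunctionallyEquivariant affineMaps.{u} (bSeries a)) ∧
    -- (b)
    (∀ a : ButcherTree → ℝ, PreservesInvariants quadraticMaps.{u} (bSeries a) →
      FunctionallyEquivariant quadraticMaps.{u} (bSeries a)) ∧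
    -- the example in (b): Gauss–Legendre methods as B-series, then as maps (Runge–Kutta steps)
    (∀ (s : ℕ) (c : Fin s → ℝ), IsGaussNodes c →
      PreservesInvariants quadraticMaps.{u}
        (bSeries (rkWeight (collocationMatrix c) (collocationWeights c))) ∧
      FunctionallyEquivariant quadraticMaps.{u}
        (bSeries (rkWeight (collocationMatrix c) (collocationWeights c))) ∧
      ∀ (Y Z : Type u) [NormedAddCommGroup Y] [NormedSpace ℝ Y] [CompleteSpace Y]
        [NormedAddCommGroup Z] [NormedSpace ℝ Z] [CompleteSpace Z] (F : Y → Z),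
        quadraticMaps Y Z F → ∀ f : Y → Y, ContDiff ℝ ∞ f →
          (IsFirstIntegral F f → ∀ y₀ y₁ : Y,
            RKStep (collocationMatrix c) (collocationWeights c) f y₀ y₁ → F y₁ = F y₀) ∧
          ∀ (y₀ : Y) (p : Y × Z),
            RKStep (collocationMatrix c) (collocationWeights c) (augmentedField F f)
                (y₀, F y₀) p ↔
              ∃ y₁ : Y, RKStep (collocationMatrix c) (collocationWeights c) f y₀ y₁ ∧
                p = (y₁, F y₁)) ∧
    -- (c)
    (∀ a : ButcherTree → ℝ, (∀ r : ℝ, ¬ IsExactFlow.{u} r (bSeries a)) →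
      ¬ FunctionallyEquivariant cubicMaps.{u} (bSeries a)) := by
  refine ⟨bSeries_affine_equivariant, bSeries_quadratic_equivariant, fun s c hc => ?_,
    fun a ha h => ha _ (isExactFlow_of_cubic_equivariant h)⟩
  have hinv := bSeries_rk_preservesInvariants.{u} hc.symplectic
  exact ⟨hinv, bSeries_quadratic_equivariant _ hinv, fun Y Z _ _ _ _ _ _ F hF f _ =>
    ⟨fun hf _ _ h => h.apply_eq hc.symplectic hF hf,
      fun y₀ p => rkStep_augmentedField_iff hc.symplectic hF f y₀ p⟩⟩
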